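/- **Setting.** Let $f:2^{[n]}\to\mathbb R_{\ge 0}$ be a non-negative submodular function (not necessarily monotone), i.e. $f(X\mid Y)\ge f(X\mid Z)$ whenever $Y\subseteq Z$ and $X\cap Z=\emptyset$, where $f(X\mid Y)=f(X\cup Y)-f(Y)$. Let $\mathcal M\subseteq 2^{[n]}$ be (the family of independent sets of) a matroid on $[n]$ of rank $r\in\mathbb Z_{\ge0}$. Let $F(x)=\sum_{S\subseteq[n]}\prod_{i\in S}x_i\prod_{i\notin S}(1-x_i)\,f(S)$ be the multi-linear extension of $f$, and $F(x\mid y)=F(x+y)-F(y)$. For a finite non-empty $I\subset\mathbb R$, let $\lfloor a\rfloor_I$ be the largest element of $I$ that is at most $a$, or $\min I$ if there is none. **Subroutine Continuous-Greedy-Filtering$(f,\mathcal M,r,\varepsilon)$**, where $1/\varepsilon\in\mathbb N^+$. If $r=0$, return $S=H=\emptyset$. Otherwise: 1. Put $v=\max_{e\in[n]}f(\{e\})$. 2. Put $x^0=\mathbf 0$. For $t=1,\dots,1/\varepsilon$: let $S_0^t=\emptyset$; for $i=1,\dots,r$, sample $V_i^t$ by including each element of $[n]$ independently with probability $\varepsilon^3/r$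 (all samples being independent of each other), and let $C_i^t$ be the set of those $e\in V_i^t\setminus S_{i-1}^t$ with $S_{i-1}^t\cup\{e\}\in\mathcal M$. If some $e\in C_i^t$ satisfies $F(\varepsilon\mathbf 1_e\mid x^{t-1}+\varepsilon\mathbf 1_{S_{i-1}^t})\ge 0$, let $s_i^t\in C_i^t$ be a maximizer of this quantity over $C_i^t$ and put $S_i^t=S_{i-1}^t\cup\{s_i^t\}$; otherwise put $S_i^t=S_{i-1}^t$. Put $\Delta_i^t=\mathbf 1_{S_i^t}-\mathbf 1_{S_{i-1}^t}$. After step $r$, put $x^t=x^{t-1}+\varepsilon\mathbf 1_{S_r^t}$. Ties among maximizers are broken by an arbitrary fixed rule, which may depend on $t$ and $i$. 3. Put $I=\{(1+\varepsilon)^i\varepsilon^2v/r : i=0,\dots,\lceil\log_{1+\varepsilon}(r/\varepsilon)\rceil\}$ and $H=\emptyset$. For $j=1,\dots,n$ in order: add $j$ to $H$ if there are $t\in[1/\varepsilon]$ and $i\in[r]$ with $j\notin S_{i-1}^t$, $S_{i-1}^t\cup\{j\}\in\mathcal M$ and $\lfloor F(\varepsilon\mathbf 1_j\mid x^{t-1}+\varepsilon\mathbf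 1_{S_{i-1}^t})\rfloor_I>\lfloor F(\varepsilon\Delta_i^t\mid x^{t-1}+\varepsilon\mathbf 1_{S_{i-1}^t})\rfloor_I$; then stop the loop if $|H|>r\ln(r/\varepsilon^2)\,|I|/\varepsilon^4$. Return $S=\bigcup_{t=1}^{1/\varepsilon}S_r^t$ and $H$. **Theorem.** Let $\varepsilon<\frac14$ with $1/\varepsilon\in\mathbb N^+$, and let $O\in\mathcal M$ be any optimal solution, i.e. $f(O)=\max_{X\in\mathcal M}f(X)$. If $r\ge1$, assume that $f(\{e\})\le f(O)$ for every loop $e$ of $\mathcal M$, i.e. every $e\in[n]$ with $\{e\}\notin\mathcal M$ (this is void if $\mathcal M$ has no loops). Then, with probability at least $1-2\varepsilon$ over the samples, the output $S,H$ of Continuous-Greedy-Filtering$(f,\mathcal M,r,\varepsilon)$ has the property that there exists $X\subseteq S$ with $X\in\mathcal M$ and $$f(X)\ \ge\ \Bigl(1-\frac1e\Bigr)\bigl(f(O\setminus H)-8\varepsilon\, f(O)\bigr).$$ -/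

import Mathlib

namespace ContGreedy

/-- `f(X | Y) = f(X ∪ Y) - f(Y)`, the marginal value of `X` with respect to `Y`. -/
def setMarginal {n : ℕ} (f : Finset (Fin n) → ℝ) (X Y : Finset (Fin n)) : ℝ :=
  f (X ∪ Y) - f Y

/-- Submodularity by diminishing marginal values: `f(X | Y) ≥ f(X | Z)` for `Y ⊆ Z` and every set
`X` disjoint from `Z`.  (Without disjointness the inequality would force `f` to be monotone.) -/
def IsSubmodular {n : ℕ} (f : Finset (Fin n) → ℝ) : Prop :=
  ∀ X Y Z : Finset (Fin n), Y ⊆ Z → Disjoint X Z → setMarginal f X Z ≤ setMarginal f X Y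

/-- `O` maximizes `f` over the independent sets of `M`. -/
def IsOptimal {n : ℕ} (f : Finset (Fin n) → ℝ) (M : Matroid (Fin n)) (O : Finset (Fin n)) : Prop :=
  M.Indep (O : Set (Fin n)) ∧ ∀ X : Finset (Fin n), M.Indep (X : Set (Fin n)) → f X ≤ f O

/-- The multi-linear extension `F` of `f`. -/
def multilinear {n : ℕ} (f : Finset (Fin n) → ℝ) (x : Fin n → ℝ) : ℝ :=
  ∑ S : Finset (Fin n), (∏ i ∈ S, x i) * (∏ i ∈ Sᶜ, (1 - x i)) * f S

/-- `F(x | y) = F(x + y) - F(y)`. -/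
def marginal {n : ℕ} (f : Finset (Fin n) → ℝ) (x y : Fin n → ℝ) : ℝ :=
  multilinear f (x + y) - multilinear f y

/-- The indicator vector `1_S`. -/
def ind {n : ℕ} (S : Finset (Fin n)) : Fin n → ℝ := fun e => if e ∈ S then 1 else 0

/-- The rounding operator: the largest element of `I` that is at most `a`, or the smallest element
of `I` if there is none. -/
noncomputable def roundDown (I : Finset ℝ) (hI : I.Nonempty) (a : ℝ) : ℝ :=
  if h : (I.filter (fun i => i ≤ a)).Nonempty then (I.filter (fun i => i ≤ a)).max' h
  else I.min' hI

/-- `e` can be added to the current solution `S` without violating the matroid constraint. -/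
def CanAdd {n : ℕ} (M : Matroid (Fin n)) (S : Finset (Fin n)) (e : Fin n) : Prop :=
  e ∉ S ∧ M.Indep (insert e (S : Set (Fin n)))

/-- `F(ε 1_e | x + ε 1_S)`, the marginal value of `e` when the fractional solution at the beginning
of the epoch is `x` and the current integral solution is `S`. -/
noncomputable def gain {n : ℕ} (f : Finset (Fin n) → ℝ) (ε : ℝ) (x : Fin n → ℝ)
    (S : Finset (Fin n)) (e : Fin n) : ℝ :=
  marginal f (ε • ind {e}) (x + ε • ind S)

open Classical in
/-- The elements of the sample `V` that can be added to `S`. -/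
noncomputable def candidates {n : ℕ} (M : Matroid (Fin n)) (V S : Finset (Fin n)) :
    Finset (Fin n) :=
  V.filter (fun e => CanAdd M S e)

/-- The set of maximizers of the marginal value among the candidates. -/
noncomputable def maximizers {n : ℕ} (f : Finset (Fin n) → ℝ) (M : Matroid (Fin n)) (ε : ℝ)
    (x : Fin n → ℝ) (V S : Finset (Fin n)) : Finset (Fin n) :=
  (candidates M V S).filter (fun e => ∀ e' ∈ candidates M V S, gain f ε x S e' ≤ gain f ε x S e)

theorem maximizers_nonempty {n : ℕ} {f : Finset (Fin n) → ℝ} {M : Matroid (Fin n)} {ε : ℝ}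
    {x : Fin n → ℝ} {V S : Finset (Fin n)}
    (h : ∃ e ∈ candidates M V S, 0 ≤ gain f ε x S e) : (maximizers f M ε x V S).Nonempty := by
  obtain ⟨e, he, -⟩ := h
  obtain ⟨m, hm, hmax⟩ := Finset.exists_max_image (candidates M V S) (gain f ε x S) ⟨e, he⟩
  exact ⟨m, Finset.mem_filter.2 ⟨hm, hmax⟩⟩

/-- A rule for breaking ties in the `argmax` of step `i` of epoch `t` (both counted from `0`): it
picks an element of the set of maximizers. -/
structure TieBreak (n : ℕ) where
  pick : ℕ → ℕ → (T : Finset (Fin n)) → T.Nonempty → Fin n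
  pick_mem : ∀ t i T hT, pick t i T hT ∈ T

open Classical in
/-- One step of the second phase: from the current integral solution `S` and the sample `V`,
produce the next integral solution. -/
noncomputable def greedyStep {n : ℕ} (f : Finset (Fin n) → ℝ) (M : Matroid (Fin n)) (ε : ℝ)
    (pick : (T : Finset (Fin n)) → T.Nonempty → Fin n) (x : Fin n → ℝ) (V S : Finset (Fin n)) :
    Finset (Fin n) :=
  if h : ∃ e ∈ candidates M V S, 0 ≤ gain f ε x S e then
    insert (pick (maximizers f M ε x V S) (maximizers_nonempty h)) S
  else S

/-- The integral solution after `i` steps of an epoch that starts from the fractional solution `x`;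
`V i` is the sample of the `i`-th step, counted from `0`. -/
noncomputable def epochSol {n : ℕ} (f : Finset (Fin n) → ℝ) (M : Matroid (Fin n)) (ε : ℝ)
    (pick : ℕ → (T : Finset (Fin n)) → T.Nonempty → Fin n) (x : Fin n → ℝ)
    (V : ℕ → Finset (Fin n)) : ℕ → Finset (Fin n)
  | 0 => ∅
  | i + 1 => greedyStep f M ε (pick i) x (V i) (epochSol f M ε pick x V i)

/-- The fractional solution after `t` epochs of `r` steps each. -/
noncomputable def fracSol {n : ℕ} (f : Finset (Fin n) → ℝ) (M : Matroid (Fin n)) (r : ℕ) (ε : ℝ)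
    (tie : TieBreak n) (V : ℕ → ℕ → Finset (Fin n)) : ℕ → Fin n → ℝ
  | 0 => 0
  | t + 1 => fracSol f M r ε tie V t +
      ε • ind (epochSol f M ε (tie.pick t) (fracSol f M r ε tie V t) (V t) r)

/-- The integral solution after `i` steps of epoch `t` (epochs counted from `0`). -/
noncomputable def intSol {n : ℕ} (f : Finset (Fin n) → ℝ) (M : Matroid (Fin n)) (r : ℕ) (ε : ℝ)
    (tie : TieBreak n) (V : ℕ → ℕ → Finset (Fin n)) (t i : ℕ) : Finset (Fin n) :=
  epochSol f M ε (tie.pick t) (fracSol f M r ε tie V t) (V t) i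

/-- `v = max_e f({e})`. (The subroutine uses it only for `0 < r`, and then `0 < n`.) -/
noncomputable def maxSingleton {n : ℕ} (f : Finset (Fin n) → ℝ) : ℝ := ⨆ e : Fin n, f {e}

/-- The grid `I = {(1 + ε)^i ε² v / r : i = 0, …, ⌈log_{1+ε} (r / ε)⌉}`. -/
noncomputable def grid (r : ℕ) (ε v : ℝ) : Finset ℝ :=
  (Finset.range (⌈Real.logb (1 + ε) (r / ε)⌉₊ + 1)).image (fun i => (1 + ε) ^ i * (ε ^ 2 * v / r))

theorem grid_nonempty (r : ℕ) (ε v : ℝ) : (grid r ε v).Nonempty :=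
  Finset.Nonempty.image Finset.nonempty_range_add_one _

/-- The filter condition of the third phase for the element `j`, with `N` epochs. -/
def PassesFilter {n : ℕ} (f : Finset (Fin n) → ℝ) (M : Matroid (Fin n)) (r N : ℕ) (ε : ℝ)
    (tie : TieBreak n) (V : ℕ → ℕ → Finset (Fin n)) (j : Fin n) : Prop :=
  let I := grid r ε (maxSingleton f)
  let hI : I.Nonempty := grid_nonempty r ε (maxSingleton f)
  let x := fracSol f M r ε tie V
  let S := intSol f M r ε tie V
  ∃ t < N, ∃ i < r, CanAdd M (S t i) j ∧
    roundDown I hI (marginal f (ε • (ind (S t (i + 1)) - ind (S t i))) (x t + ε • ind (S t i))) <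
      roundDown I hI (gain f ε (x t) (S t i) j)

open Classical in
/-- The loop of the third phase: go through the list, insert the elements that satisfy `P`, and
stop as soon as the set has more than `bound` elements. -/
noncomputable def filterLoop {n : ℕ} (P : Fin n → Prop) (bound : ℝ) :
    List (Fin n) → Finset (Fin n) → Finset (Fin n)
  | [], H => H
  | j :: l, H =>
    let H' := if P j then insert j H else H
    if bound < (H'.card : ℝ) then H' else filterLoop P bound l H'

/-- The subroutine Continuous-Greedy-Filtering on the input `(f, M, r, ε)`, where the sample of step
`i` of epoch `t` is `V t i` (both counted from `0`).  The output is the pair `(S, H)`. -/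
noncomputable def continuousGreedyFiltering {n : ℕ} (f : Finset (Fin n) → ℝ) (M : Matroid (Fin n))
    (r : ℕ) (ε : ℝ) (tie : TieBreak n) (V : ℕ → ℕ → Finset (Fin n)) :
    Finset (Fin n) × Finset (Fin n) :=
  let N := ⌊1 / ε⌋₊
  if r = 0 then (∅, ∅)
  else
    ((Finset.range N).biUnion (fun t => intSol f M r ε tie V t r),
      filterLoop (PassesFilter f M r N ε tie V)
        (r * Real.log (r / ε ^ 2) * (grid r ε (maxSingleton f)).card / ε ^ 4)
        (List.finRange n) ∅)

/-- The outcomes of the sampling: a subset of `[n]` for each of the `r` steps of `N` epochs. -/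
abbrev Samples (n N r : ℕ) : Type := Fin N → Fin r → Finset (Fin n)

/-- The samples as a doubly indexed sequence. (The values outside the range are never used.) -/
def Samples.toSeq {n N r : ℕ} (V : Samples n N r) (t i : ℕ) : Finset (Fin n) :=
  if h : t < N ∧ i < r then V ⟨t, h.1⟩ ⟨i, h.2⟩ else ∅

/-- The probability of the outcome `V` when every element is included in every sample independently
with probability `p`. -/
def sampleWeight {n N r : ℕ} (p : ℝ) (V : Samples n N r) : ℝ :=
  ∏ t, ∏ i, ∏ e, if e ∈ V t i then p else 1 - p

open Classical in
/-- The probability of an event under this independent sampling. -/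
noncomputable def sampleProb (n N r : ℕ) (p : ℝ) (E : Samples n N r → Prop) : ℝ :=
  ∑ V ∈ Finset.univ.filter E, sampleWeight p V

/-- The weights of all outcomes sum to one. -/
theorem sum_sampleWeight (n N r : ℕ) (p : ℝ) : ∑ V : Samples n N r, sampleWeight p V = 1 := by
  have h1 : ∑ S : Finset (Fin n), ∏ e, (if e ∈ S then p else 1 - p) = 1 := by
    have h := Finset.prod_add (fun _ : Fin n => p) (fun _ => 1 - p) Finset.univ
    have h0 : ∏ _i : Fin n, (p + (1 - p)) = 1 := by simp
    rw [h0, Finset.powerset_univ] at h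
    refine Eq.trans (Finset.sum_congr rfl fun S _ => ?_) h.symm
    rw [Finset.prod_ite]
    congr 1
    · exact Finset.prod_congr (by ext; simp) fun _ _ => rfl
    · exact Finset.prod_congr (by ext; simp) fun _ _ => rfl
  have h2 : ∑ W : Fin r → Finset (Fin n), ∏ i, ∏ e, (if e ∈ W i then p else 1 - p) = 1 := by
    have h := Finset.sum_prod_piFinset (Finset.univ : Finset (Finset (Fin n)))
      (fun (_ : Fin r) S => ∏ e, if e ∈ S then p else 1 - p)
    rw [Fintype.piFinset_univ] at h
    rw [h]
    simp [h1]
  have h := Finset.sum_prod_piFinset (Finset.univ : Finset (Fin r → Finset (Fin n)))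
    (fun (_ : Fin N) W => ∏ i, ∏ e, if e ∈ W i then p else 1 - p)
  rw [Fintype.piFinset_univ] at h
  unfold sampleWeight
  rw [h]
  simp [h2]

end ContGreedy

namespace ContGreedy

variable {n : ℕ}

/-! Randomness enters only through two bad events, each of probability at most `ε`; outside them the
guarantee is deterministic.

First event: some sample misses a large set of addable elements of gain at least `τ`. Before a step
these sets form a chain in `τ` that does not depend on the sample of that step, so only the smallest
one with more than `k = r ln(r/ε²)/ε³` elements matters. It is missed with probability at most
`exp(-pk) = ε²/r`, and there are `r/ε` steps (`sampleProb_not_hitsLarge_le`). If nothing is missed,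
each pair of an epoch and a grid value accounts for at most `k` filtered elements
(`card_passesFilter_le`). Hence the filter loop is never cut off, and no element of `O \ H` passes
the filter.

Second event: some set `T` of sampled elements has `f (O ∪ T) < (1 - ε) f O`. Each element is ever
sampled with probability at most `ε²`, so even the worst `T` satisfies `E f (O ∪ T) ≥ (1 - ε²) f O`,
and Markov's inequality applies (`sampleProb_exists_bad_subset_le`).

Outside both events, matroid exchange assigns to the elements of `O \ H` distinct steps of an epoch
at which they were still addable. Failing the filter bounds their gains there by those of the greedy
choices, up to rounding (`epoch_progress`, `le_of_roundDown_grid_le`). By `le_multilinear_join`,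
raising the coordinates in `O \ H` to 1 yields at least `f (O \ H) - ε f O`. The resulting
recurrence for `F (x^t)` gives the factor `1 - 1/e` (`one_sub_inv_exp_mul_le`). Finally, swap
rounding turns the fractional solution, an average of independent sets, into one independent subset
of `S` without loss (`exists_rounding`). -/

theorem IsSubmodular.union_add_inter_le {f : Finset (Fin n) → ℝ} (hf : IsSubmodular f)
    (A B : Finset (Fin n)) : f (A ∪ B) + f (A ∩ B) ≤ f A + f B := by
  have h := hf (A \ B) (A ∩ B) B Finset.inter_subset_right Finset.sdiff_disjoint
  unfold setMarginal at h
  have h1 : A \ B ∪ B = A ∪ B := by ext x; simp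
  have h2 : A \ B ∪ A ∩ B = A := Finset.sdiff_union_inter A B
  rw [h1, h2] at h
  linarith

/-! ### Multi-linear extension: partial derivatives and their monotonicity -/

/-- The marginal value of `e` with respect to `S`, not counting `e` itself. -/
def diff (f : Finset (Fin n) → ℝ) (e : Fin n) (S : Finset (Fin n)) : ℝ :=
  f (insert e S) - f (S.erase e)

/-- The probability of `S` when `i` is included independently with probability `x i`. -/
def weight (x : Fin n → ℝ) (A S : Finset (Fin n)) : ℝ :=
  ∏ i ∈ A, if i ∈ S then x i else 1 - x i

theorem multilinear_eq_sum_weight (f : Finset (Fin n) → ℝ) (x : Fin n → ℝ) :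
    multilinear f x = ∑ S, weight x Finset.univ S * f S := by
  refine Finset.sum_congr rfl fun S _ => ?_
  rw [weight, Finset.prod_ite]
  congr 2
  · exact Finset.prod_congr (by ext; simp) fun _ _ => rfl
  · exact Finset.prod_congr (by ext; simp) fun _ _ => rfl

theorem weight_insert_of_notMem {x : Fin n → ℝ} {A : Finset (Fin n)} {e : Fin n} (he : e ∉ A)
    (S : Finset (Fin n)) : weight x A (insert e S) = weight x A S := by
  refine Finset.prod_congr rfl fun i hi => ?_
  have : i ≠ e := fun h => he (h ▸ hi)
  simp [this]

theorem weight_add_of_notMem {x : Fin n → ℝ} {A : Finset (Fin n)} {e : Fin n} (he : e ∉ A) (s : ℝ)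
    (S : Finset (Fin n)) : weight (x + s • ind {e}) A S = weight x A S := by
  refine Finset.prod_congr rfl fun i hi => ?_
  have : i ≠ e := fun h => he (h ▸ hi)
  simp [this, ind]

/-- Conditioning on whether the random set contains `e` isolates the dependence on the coordinate `x
e`. -/
theorem multilinear_split (f : Finset (Fin n) → ℝ) (x : Fin n → ℝ) (e : Fin n) :
    multilinear f x = ∑ T ∈ (Finset.univ.erase e).powerset,
      weight x (Finset.univ.erase e) T * ((1 - x e) * f T + x e * f (insert e T)) := by
  have he : e ∉ (Finset.univ.erase e : Finset (Fin n)) := Finset.notMem_erase _ _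
  have hu : (Finset.univ : Finset (Fin n)) = insert e (Finset.univ.erase e) := by simp
  have hs : (Finset.univ : Finset (Finset (Fin n))) =
      (insert e (Finset.univ.erase e : Finset (Fin n))).powerset := by
    rw [← hu, Finset.powerset_univ]
  rw [multilinear_eq_sum_weight, hs, Finset.sum_powerset_insert he, ← Finset.sum_add_distrib]
  refine Finset.sum_congr rfl fun T hT => ?_
  have heT : e ∉ T := fun h => he (Finset.mem_powerset.1 hT h)
  have hw : ∀ S, weight x Finset.univ S =
      (if e ∈ S then x e else 1 - x e) * weight x (Finset.univ.erase e) S := by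
    intro S
    unfold weight
    rw [Finset.mul_prod_erase Finset.univ (fun i => if i ∈ S then x i else 1 - x i)
      (Finset.mem_univ e)]
  rw [hw, hw, weight_insert_of_notMem he]
  simp only [heT, if_false, Finset.mem_insert_self, if_true]
  ring

/-- The multi-linear extension is affine in each coordinate. -/
theorem multilinear_add_smul (f : Finset (Fin n) → ℝ) (x : Fin n → ℝ) (e : Fin n) (s : ℝ) :
    multilinear f (x + s • ind {e}) = multilinear f x + s * multilinear (diff f e) x := by
  have he : e ∉ (Finset.univ.erase e : Finset (Fin n)) := Finset.notMem_erase _ _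
  rw [multilinear_split f _ e, multilinear_split f x e, multilinear_split (diff f e) x e,
    Finset.mul_sum, ← Finset.sum_add_distrib]
  refine Finset.sum_congr rfl fun T hT => ?_
  have heT : e ∉ T := fun h => he (Finset.mem_powerset.1 hT h)
  rw [weight_add_of_notMem he]
  have h1 : (x + s • ind {e}) e = x e + s := by simp [ind]
  simp only [h1, diff, Finset.insert_idem, Finset.erase_eq_of_notMem heT,
    Finset.erase_insert heT]
  ring

theorem sum_prod_ite_mem (u v : Fin n → ℝ) :
    ∑ S : Finset (Fin n), ∏ i, (if i ∈ S then u i else v i) = ∏ i, (u i + v i) := by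
  rw [Finset.prod_add, Finset.powerset_univ]
  refine Finset.sum_congr rfl fun S _ => ?_
  rw [Finset.prod_ite]
  congr 1
  · exact Finset.prod_congr (by ext; simp) fun _ _ => rfl
  · exact Finset.prod_congr (by ext; simp) fun _ _ => rfl

theorem sum_weight (x : Fin n → ℝ) : ∑ S, weight x Finset.univ S = 1 := by
  simp [weight, sum_prod_ite_mem]

/-- A lower bound for the values of `f` in the support of `x` is a lower bound for its multi-linear
extension at `x`. -/
theorem le_multilinear {f : Finset (Fin n) → ℝ} {x : Fin n → ℝ} (h0 : 0 ≤ x) (h1 : x ≤ 1) {c : ℝ}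
    (h : ∀ S, (∀ e, x e = 1 → e ∈ S) → (∀ e, x e = 0 → e ∉ S) → c ≤ f S) :
    c ≤ multilinear f x := by
  rw [multilinear_eq_sum_weight]
  calc c = ∑ S, weight x Finset.univ S * c := by rw [← Finset.sum_mul, sum_weight, one_mul]
    _ ≤ _ := by
      refine Finset.sum_le_sum fun S _ => ?_
      by_cases hS : (∀ e, x e = 1 → e ∈ S) ∧ (∀ e, x e = 0 → e ∉ S)
      · refine mul_le_mul_of_nonneg_left (h S hS.1 hS.2) (Finset.prod_nonneg fun i _ => ?_)
        have := h0 i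
        have := h1 i
        simp only [Pi.zero_apply, Pi.one_apply] at *
        split_ifs <;> linarith
      · have : weight x Finset.univ S = 0 := by
          rw [not_and_or] at hS
          push Not at hS
          rcases hS with ⟨e, he, heS⟩ | ⟨e, he, heS⟩
          · exact Finset.prod_eq_zero (Finset.mem_univ e) (by simp [heS, he])
          · exact Finset.prod_eq_zero (Finset.mem_univ e) (by simp [heS, he])
        simp [this]

theorem multilinear_nonneg {f : Finset (Fin n) → ℝ} (hf : ∀ S, 0 ≤ f S) {x : Fin n → ℝ}
    (h0 : 0 ≤ x) (h1 : x ≤ 1) : 0 ≤ multilinear f x :=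
  le_multilinear h0 h1 fun S _ _ => hf S

theorem multilinear_neg (f : Finset (Fin n) → ℝ) (x : Fin n → ℝ) :
    multilinear (fun S => -f S) x = -multilinear f x := by
  simp [multilinear]

theorem multilinear_ind (f : Finset (Fin n) → ℝ) (A : Finset (Fin n)) :
    multilinear f (ind A) = f A := by
  have h0 : (0 : Fin n → ℝ) ≤ ind A := fun e => by simp only [ind]; split_ifs <;> simp
  have h1 : ind A ≤ (1 : Fin n → ℝ) := fun e => by simp only [ind]; split_ifs <;> simp
  have key : ∀ S, (∀ e, ind A e = 1 → e ∈ S) → (∀ e, ind A e = 0 → e ∉ S) → S = A := by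
    intro S hS1 hS2
    ext e
    by_cases he : e ∈ A
    · simp [he, hS1 e (by simp [ind, he])]
    · simp [he, hS2 e (by simp [ind, he])]
  refine le_antisymm ?_ (le_multilinear h0 h1 fun S h h' => by rw [key S h h'])
  have := le_multilinear (f := fun S => -f S) h0 h1 (c := -f A) fun S h h' => by rw [key S h h']
  rw [multilinear_neg] at this
  linarith

theorem ind_empty : ind (∅ : Finset (Fin n)) = 0 := by
  funext e; simp [ind]

theorem ind_insert {e : Fin n} {S : Finset (Fin n)} (he : e ∉ S) :
    ind (insert e S) = ind S + ind {e} := by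
  funext i
  by_cases h : i = e
  · subst h; simp [ind, he]
  · simp [ind, h]

theorem ind_nonneg (S : Finset (Fin n)) : 0 ≤ ind S := fun e => by
  simp only [ind]; split_ifs <;> simp

theorem ind_le_one (S : Finset (Fin n)) : ind S ≤ 1 := fun e => by
  simp only [ind]; split_ifs <;> simp

theorem ind_mono {S T : Finset (Fin n)} (h : S ⊆ T) : ind S ≤ ind T := fun e => by
  by_cases he : e ∈ S
  · simp [ind, he, h he]
  · simp only [ind, he, if_false]; split_ifs <;> simp

/-- The multi-linear extension of a function with non-positive differences is antitone. -/
theorem multilinear_antitone {f : Finset (Fin n) → ℝ} (hf : ∀ e S, diff f e S ≤ 0)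
    {x y : Fin n → ℝ} (h0 : 0 ≤ x) (hxy : x ≤ y) (h1 : y ≤ 1) :
    multilinear f y ≤ multilinear f x := by
  -- The coordinates are switched from `x` to `y` one at a time.
  have key : ∀ A : Finset (Fin n),
      multilinear f (fun i => if i ∈ A then y i else x i) ≤ multilinear f x := by
    intro A
    induction A using Finset.induction_on with
    | empty => simp
    | insert e A he ih =>
      have hz : (fun i => if i ∈ insert e A then y i else x i) =
          (fun i => if i ∈ A then y i else x i) + (y e - x e) • ind {e} := by
        funext i
        by_cases h : i = e
        · subst h; simp [he, ind]
        · simp [h, ind]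
      rw [hz, multilinear_add_smul]
      refine le_trans ?_ ih
      have hd : 0 ≤ multilinear (fun S => -diff f e S)
          (fun i => if i ∈ A then y i else x i) := by
        refine multilinear_nonneg (fun S => by linarith [hf e S]) (fun i => ?_) (fun i => ?_)
        · have := h0 i; have := hxy i; dsimp only; split_ifs <;> simp at * <;> linarith
        · have := h1 i; have := hxy i; dsimp only; split_ifs <;> simp at * <;> linarith
      rw [multilinear_neg] at hd
      have := mul_nonneg (sub_nonneg.2 (hxy e)) hd
      linarith
  simpa using key Finset.univ

/-- For `g ≠ e` this is submodularity for the two sets that contain exactly one of `e`, `g` and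
agree with `S` elsewhere. For `g = e` the second difference is 0, because `diff f e` ignores `e`. -/
theorem IsSubmodular.diff_diff_nonpos {f : Finset (Fin n) → ℝ} (hf : IsSubmodular f)
    (e g : Fin n) (S : Finset (Fin n)) : diff (diff f e) g S ≤ 0 := by
  unfold diff
  by_cases h : g = e
  · subst h
    have : insert g (S.erase g) = insert g S := by
      ext i; simp only [Finset.mem_insert, Finset.mem_erase]; tauto
    simp [this]
  · have h1 := hf.union_add_inter_le (insert e (S.erase g)) ((insert g S).erase e)
    have h2 : insert e (S.erase g) ∪ (insert g S).erase e = insert e (insert g S) := by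
      ext i; simp only [Finset.mem_union, Finset.mem_insert, Finset.mem_erase]; tauto
    have h3 : insert e (S.erase g) ∩ (insert g S).erase e = (S.erase g).erase e := by
      ext i
      simp only [Finset.mem_inter, Finset.mem_insert, Finset.mem_erase]
      tauto
    rw [h2, h3] at h1
    linarith

theorem IsSubmodular.multilinear_diff_antitone {f : Finset (Fin n) → ℝ} (hf : IsSubmodular f)
    (e : Fin n) {x y : Fin n → ℝ} (h0 : 0 ≤ x) (hxy : x ≤ y) (h1 : y ≤ 1) :
    multilinear (diff f e) y ≤ multilinear (diff f e) x :=
  multilinear_antitone (fun g S => hf.diff_diff_nonpos e g S) h0 hxy h1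

theorem IsSubmodular.multilinear_diff_le {f : Finset (Fin n) → ℝ} (hf : IsSubmodular f)
    (e : Fin n) {x : Fin n → ℝ} (h0 : 0 ≤ x) (h1 : x ≤ 1) :
    multilinear (diff f e) x ≤ f {e} - f ∅ := by
  refine (hf.multilinear_diff_antitone e le_rfl h0 h1).trans_eq ?_
  rw [← ind_empty, multilinear_ind]
  simp [diff]

/-- Raising coordinate `e` to 1 adds `1 - x e` times a derivative that has only decreased since `x`.
As `f` need not be monotone, the derivative may be negative, and the factor in `[0, 1]` can be
dropped only after taking the positive part. -/
theorem IsSubmodular.multilinear_join_le {f : Finset (Fin n) → ℝ} (hf : IsSubmodular f)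
    {x : Fin n → ℝ} (h0 : 0 ≤ x) (h1 : x ≤ 1) (A : Finset (Fin n)) :
    multilinear f (fun i => if i ∈ A then 1 else x i) ≤
      multilinear f x + ∑ e ∈ A, max (multilinear (diff f e) x) 0 := by
  induction A using Finset.induction_on with
  | empty => simp
  | insert e A he ih =>
    have hz : (fun i => if i ∈ insert e A then 1 else x i) =
        (fun i => if i ∈ A then 1 else x i) + (1 - x e) • ind {e} := by
      funext i
      by_cases h : i = e
      · subst h; simp [he, ind]
      · simp [h, ind]
    rw [hz, multilinear_add_smul, Finset.sum_insert he]
    have hd := hf.multilinear_diff_antitone e (x := x) (y := fun i => if i ∈ A then 1 else x i) h0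
      (fun i => by have := h1 i; dsimp only; split_ifs <;> simp_all)
      (fun i => by have := h1 i; dsimp only; split_ifs <;> simp_all)
    have h2 : 0 ≤ 1 - x e := sub_nonneg.2 (h1 e)
    have h3 : 1 - x e ≤ 1 := by have := h0 e; simp at this; linarith
    have h4 := mul_le_mul_of_nonneg_left
      (hd.trans (le_max_left (multilinear (diff f e) x) 0)) h2
    have h5 := mul_le_mul_of_nonneg_right h3 (le_max_right (multilinear (diff f e) x) 0)
    linarith

theorem ind_erase {e : Fin n} {S : Finset (Fin n)} (he : e ∈ S) :
    ind (S.erase e) = ind S - ind {e} := by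
  funext i
  by_cases h : i = e
  · subst h; simp [ind, he]
  · simp [ind, h]

/-- The multi-linear extension of a submodular function is convex in the directions in which one
coordinate increases as much as another one decreases. -/
theorem IsSubmodular.le_multilinear_exchange {f : Finset (Fin n) → ℝ} (hf : IsSubmodular f)
    {x : Fin n → ℝ} (h0 : 0 ≤ x) (h1 : x ≤ 1) (e g : Fin n) (s : ℝ) :
    multilinear f x + s * (multilinear (diff f g) x - multilinear (diff f e) x) ≤
      multilinear f (x + s • ind {g} + (-s) • ind {e}) := by
  rw [multilinear_add_smul, multilinear_add_smul, multilinear_add_smul]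
  have h := multilinear_nonneg (f := fun S => -diff (diff f e) g S)
    (fun S => by linarith [hf.diff_diff_nonpos e g S]) h0 h1
  rw [multilinear_neg] at h
  -- Along this direction the second-order term is `-s²` times the mixed second derivative, hence
  -- non-negative.
  have := mul_nonneg (mul_self_nonneg s) h
  nlinarith

/-! ### Matroid exchange and swap rounding -/

/-- Two independent sets of a finite matroid that span each other satisfy the symmetric exchange
property. -/
theorem exists_symm_exchange {α : Type*} {M : Matroid α} {I J : Set α} (hI : M.Indep I)
    (hJ : M.Indep J) (hIJ : I ⊆ M.closure J) {e : α} (he : e ∈ I) (heJ : e ∉ J) :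
    ∃ g ∈ J, g ∉ M.closure (I \ {e}) ∧ M.Indep (insert e J \ {g}) := by
  by_contra! hcon
  -- If every other element of the fundamental circuit of `e` in `J` were spanned by `I \ {e}`, then
  -- so would be `e`, contradicting the independence of `I`.
  have hC := hJ.fundCircuit_isCircuit (hIJ he) heJ
  have hsub : M.fundCircuit e J \ {e} ⊆ M.closure (I \ {e}) := by
    rintro g ⟨hg, hge⟩
    have hgJ : g ∈ J := (Matroid.fundCircuit_subset_insert M e J hg).resolve_left hge
    by_contra hgc
    exact hcon g hgJ hgc ((hJ.mem_fundCircuit_iff (hIJ he) heJ).1 hg)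
  have h1 := hC.mem_closure_sdiff_singleton_of_mem (M.mem_fundCircuit e J)
  exact hI.notMem_closure_sdiff_of_mem he (M.closure_subset_closure_of_subset_closure hsub h1)

section Merge

variable {f : Finset (Fin n) → ℝ} {M : Matroid (Fin n)} {y : Fin n → ℝ} {a b : ℝ}
  {I J : Finset (Fin n)}

/-- `F` is affine in the coordinate `e`: if its slope is non-negative, adding `e` to `I` does not
hurt; otherwise deleting `e` from `J` does not. -/
theorem exists_closer_of_augment (ha : 0 ≤ a) (hb : 0 ≤ b)
    (hI : M.Indep (I : Set (Fin n))) (hJ : M.Indep (J : Set (Fin n))) {e : Fin n} (heJ : e ∈ J)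
    (heI : e ∉ I) (hins : M.Indep (insert e (I : Set (Fin n)))) :
    ∃ I' J' : Finset (Fin n), I' ∪ J' ⊆ I ∪ J ∧ M.Indep (I' : Set (Fin n)) ∧
      M.Indep (J' : Set (Fin n)) ∧
      (I' \ J').card + (J' \ I').card < (I \ J).card + (J \ I).card ∧
      multilinear f (y + a • ind I + b • ind J) ≤ multilinear f (y + a • ind I' + b • ind J') := by
  have hlt : ((J \ I).erase e).card < (J \ I).card :=
    Finset.card_erase_lt_of_mem (Finset.mem_sdiff.2 ⟨heJ, heI⟩)
  rcases le_total 0 (multilinear (diff f e) (y + a • ind I + b • ind J)) with h | h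
  · refine ⟨insert e I, J, ?_, by simpa using hins, hJ, ?_, ?_⟩
    · intro i; simp only [Finset.mem_union, Finset.mem_insert]; grind
    · have h1 : insert e I \ J = I \ J := by grind
      have h2 : J \ insert e I = (J \ I).erase e := by grind
      rw [h1, h2]; omega
    · have : y + a • ind (insert e I) + b • ind J = y + a • ind I + b • ind J + a • ind {e} := by
        rw [ind_insert heI, smul_add]; abel
      rw [this, multilinear_add_smul]
      have := mul_nonneg ha h
      linarith
  · refine ⟨I, J.erase e, ?_, hI, hJ.subset (by simp), ?_, ?_⟩
    · intro i; simp only [Finset.mem_union, Finset.mem_erase]; tauto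
    · have h1 : I \ J.erase e = I \ J := by grind
      have h2 : J.erase e \ I = (J \ I).erase e := by grind
      rw [h1, h2]; omega
    · have : y + a • ind I + b • ind (J.erase e) =
          y + a • ind I + b • ind J + (-b) • ind {e} := by
        rw [ind_erase heJ, smul_sub, neg_smul]; abel
      rw [this, multilinear_add_smul]
      have := mul_nonneg hb (neg_nonneg.2 h)
      linarith

/-- Swapping in `I` moves along `1_g - 1_e`, swapping in `J` along the opposite direction. By
convexity along this line, the sign of the slope tells which swap does not lower `F`. -/
theorem IsSubmodular.exists_closer_of_exchange (hf : IsSubmodular f) (ha : 0 ≤ a) (hb : 0 ≤ b)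
    (h0 : 0 ≤ y) (h1 : ∀ i, y i + a + b ≤ 1) {e g : Fin n} (heI : e ∈ I) (heJ : e ∉ J)
    (hgI : g ∉ I) (hgJ : g ∈ J) (hI : M.Indep (I : Set (Fin n))) (hJ : M.Indep (J : Set (Fin n)))
    (hI' : M.Indep (insert g ((I : Set (Fin n)) \ {e})))
    (hJ' : M.Indep (insert e (J : Set (Fin n)) \ {g})) :
    ∃ I' J' : Finset (Fin n), I' ∪ J' ⊆ I ∪ J ∧ M.Indep (I' : Set (Fin n)) ∧
      M.Indep (J' : Set (Fin n)) ∧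
      (I' \ J').card + (J' \ I').card < (I \ J).card + (J \ I).card ∧
      multilinear f (y + a • ind I + b • ind J) ≤ multilinear f (y + a • ind I' + b • ind J') := by
  have hz0 : 0 ≤ y + a • ind I + b • ind J := by
    have := ind_nonneg I; have := ind_nonneg J
    positivity
  have hz1 : y + a • ind I + b • ind J ≤ 1 := by
    intro i
    have := mul_le_mul_of_nonneg_left (ind_le_one I i) ha
    have := mul_le_mul_of_nonneg_left (ind_le_one J i) hb
    have := h1 i
    simp only [Pi.add_apply, Pi.smul_apply, smul_eq_mul, Pi.one_apply] at *
    linarith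
  have hge : g ≠ e := fun h => hgI (h ▸ heI)
  have hlt1 : ((J \ I).erase g).card < (J \ I).card :=
    Finset.card_erase_lt_of_mem (Finset.mem_sdiff.2 ⟨hgJ, hgI⟩)
  have hlt2 : ((I \ J).erase e).card < (I \ J).card :=
    Finset.card_erase_lt_of_mem (Finset.mem_sdiff.2 ⟨heI, heJ⟩)
  have hgIe : g ∉ I.erase e := by grind
  have heJg : e ∉ J.erase g := by grind
  rcases le_total 0 (multilinear (diff f g) (y + a • ind I + b • ind J) -
    multilinear (diff f e) (y + a • ind I + b • ind J)) with h | h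
  · refine ⟨insert g (I.erase e), J, ?_, by simpa using hI', hJ, ?_, ?_⟩
    · grind
    · have h1 : insert g (I.erase e) \ J = (I \ J).erase e := by grind
      have h2 : J \ insert g (I.erase e) = (J \ I).erase g := by grind
      rw [h1, h2]; omega
    · have : y + a • ind (insert g (I.erase e)) + b • ind J =
          y + a • ind I + b • ind J + a • ind {g} + (-a) • ind {e} := by
        rw [ind_insert hgIe, ind_erase heI, smul_add, smul_sub, neg_smul]; abel
      rw [this]
      have := hf.le_multilinear_exchange hz0 hz1 e g a
      have := mul_nonneg ha h
      linarith
  · refine ⟨I, insert e (J.erase g), ?_, hI, ?_, ?_, ?_⟩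
    · grind
    · refine hJ'.subset ?_
      intro i
      simp only [Finset.coe_insert, Finset.coe_erase, Set.mem_insert_iff, Set.mem_sdiff,
        Set.mem_singleton_iff, Finset.mem_coe]
      rintro (rfl | ⟨h, h'⟩)
      · exact ⟨Or.inl rfl, hge.symm⟩
      · exact ⟨Or.inr h, h'⟩
    · have h1 : I \ insert e (J.erase g) = (I \ J).erase e := by grind
      have h2 : insert e (J.erase g) \ I = (J \ I).erase g := by grind
      rw [h1, h2]; omega
    · have : y + a • ind I + b • ind (insert e (J.erase g)) =
          y + a • ind I + b • ind J + (-b) • ind {g} + (-(-b)) • ind {e} := by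
        rw [ind_insert heJg, ind_erase hgJ, smul_add, smul_sub, neg_smul, neg_neg]; abel
      rw [this]
      have := hf.le_multilinear_exchange hz0 hz1 e g (-b)
      have := mul_nonneg hb (neg_nonneg.2 h)
      linarith

theorem IsSubmodular.exists_closer (hf : IsSubmodular f) (hE : M.E = Set.univ) (ha : 0 ≤ a)
    (hb : 0 ≤ b) (h0 : 0 ≤ y) (h1 : ∀ i, y i + a + b ≤ 1) (hI : M.Indep (I : Set (Fin n)))
    (hJ : M.Indep (J : Set (Fin n))) (hne : I ≠ J) :
    ∃ I' J' : Finset (Fin n), I' ∪ J' ⊆ I ∪ J ∧ M.Indep (I' : Set (Fin n)) ∧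
      M.Indep (J' : Set (Fin n)) ∧
      (I' \ J').card + (J' \ I').card < (I \ J).card + (J \ I).card ∧
      multilinear f (y + a • ind I + b • ind J) ≤ multilinear f (y + a • ind I' + b • ind J') := by
  by_cases hA : ∃ e ∈ J, e ∉ I ∧ M.Indep (insert e (I : Set (Fin n)))
  · obtain ⟨e, heJ, heI, hins⟩ := hA
    exact exists_closer_of_augment ha hb hI hJ heJ heI hins
  by_cases hB : ∃ e ∈ I, e ∉ J ∧ M.Indep (insert e (J : Set (Fin n)))
  · obtain ⟨e, heI, heJ, hins⟩ := hB
    obtain ⟨J', I', hs, hJ', hI', hlt, hle⟩ :=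
      exists_closer_of_augment (f := f) (y := y) hb ha hJ hI heI heJ hins
    refine ⟨I', J', ?_, hI', hJ', by omega, ?_⟩
    · rwa [Finset.union_comm I', Finset.union_comm I]
    · rwa [add_right_comm y (a • ind I), add_right_comm y (a • ind I')]
  -- Neither set can be augmented from the other, so they span each other and symmetric exchange
  -- applies.
  have hJI : (J : Set (Fin n)) ⊆ M.closure I := by
    intro e he
    rw [hI.mem_closure_iff' ]
    refine ⟨hE ▸ Set.mem_univ e, fun h => ?_⟩
    by_contra h'
    exact hA ⟨e, he, h', h⟩
  have hIJ : (I : Set (Fin n)) ⊆ M.closure J := by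
    intro e he
    rw [hJ.mem_closure_iff' ]
    refine ⟨hE ▸ Set.mem_univ e, fun h => ?_⟩
    by_contra h'
    exact hB ⟨e, he, h', h⟩
  have hex : ∃ e ∈ I, e ∉ J := by
    by_contra! hsub
    obtain ⟨e, heJ, heI⟩ : ∃ e ∈ J, e ∉ I := by
      by_contra! h
      exact hne (Finset.Subset.antisymm hsub h)
    refine hA ⟨e, heJ, heI, hJ.subset (Set.insert_subset heJ ?_)⟩
    exact fun i hi => hsub i hi
  obtain ⟨e, heI, heJ⟩ := hex
  obtain ⟨g, hgJ, hgc, hJ'⟩ := exists_symm_exchange hI hJ hIJ heI heJ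
  have hgI : g ∉ I := by
    intro hgI
    refine hgc (M.mem_closure_of_mem' ⟨hgI, fun h => ?_⟩ (hE ▸ Set.mem_univ g))
    rw [Set.mem_singleton_iff] at h
    exact heJ (h ▸ hgJ)
  have hI' := ((hI.sdiff {e}).notMem_closure_iff (hE ▸ Set.mem_univ g)).1 hgc
  exact hf.exists_closer_of_exchange ha hb h0 h1 heI heJ hgI hgJ hI hJ hI'.1 hJ'

/-- Induction on the size of the symmetric difference: the pair is moved closer until both sets
coincide and the coefficients add up. -/
theorem IsSubmodular.exists_merge (hf : IsSubmodular f) (hE : M.E = Set.univ) (ha : 0 ≤ a)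
    (hb : 0 ≤ b) (h0 : 0 ≤ y) (h1 : ∀ i, y i + a + b ≤ 1) (I J : Finset (Fin n))
    (hI : M.Indep (I : Set (Fin n))) (hJ : M.Indep (J : Set (Fin n))) :
    ∃ K ⊆ I ∪ J, M.Indep (K : Set (Fin n)) ∧
      multilinear f (y + a • ind I + b • ind J) ≤ multilinear f (y + (a + b) • ind K) := by
  induction hm : (I \ J).card + (J \ I).card using Nat.strong_induction_on generalizing I J with
  | _ m ih =>
    by_cases hne : I = J
    · subst hne
      exact ⟨I, by simp, hI, by rw [add_smul, add_assoc]⟩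
    · obtain ⟨I', J', hs, hI', hJ', hlt, hle⟩ := hf.exists_closer hE ha hb h0 h1 hI hJ hne
      obtain ⟨K, hK, hKi, hKle⟩ := ih _ (hm ▸ hlt) I' J' hI' hJ' rfl
      exact ⟨K, hK.trans hs, hKi, hle.trans hKle⟩

end Merge

/-- Swap rounding. -/
theorem IsSubmodular.exists_rounding {f : Finset (Fin n) → ℝ} (hf : IsSubmodular f)
    {M : Matroid (Fin n)} (hE : M.E = Set.univ) {ε : ℝ} (hε : 0 ≤ ε) (I : ℕ → Finset (Fin n))
    (hI : ∀ t, M.Indep (I t : Set (Fin n))) (N : ℕ) (y : Fin n → ℝ) (h0 : 0 ≤ y)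
    (h1 : ∀ i, y i + N * ε ≤ 1) :
    ∃ K ⊆ (Finset.range N).biUnion I, M.Indep (K : Set (Fin n)) ∧
      multilinear f (y + ∑ t ∈ Finset.range N, ε • ind (I t)) ≤
        multilinear f (y + (N * ε) • ind K) := by
  induction N generalizing y with
  | zero => exact ⟨∅, by simp, by simp, by simp⟩
  | succ N ih =>
    have hs : 0 ≤ ε • ind (I N) := smul_nonneg hε (ind_nonneg _)
    obtain ⟨K, hK, hKi, hle⟩ := ih (y + ε • ind (I N)) (add_nonneg h0 hs) (fun i => by
      have := mul_le_mul_of_nonneg_left (ind_le_one (I N) i) hε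
      have := h1 i
      push_cast at this
      simp only [Pi.add_apply, Pi.smul_apply, smul_eq_mul, Pi.one_apply] at *
      linarith)
    obtain ⟨L, hL, hLi, hle'⟩ := hf.exists_merge hE hε (by positivity : (0 : ℝ) ≤ N * ε) h0
      (fun i => by have := h1 i; push_cast at this; linarith) (I N) K (hI N) hKi
    refine ⟨L, fun i hi => ?_, hLi, ?_⟩
    · rw [Finset.range_add_one, Finset.biUnion_insert]
      exact Finset.union_subset_union_right hK (hL hi)
    · rw [Finset.sum_range_succ, add_comm (∑ t ∈ _, _), ← add_assoc]
      refine hle.trans (hle'.trans_eq ?_)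
      congr 3
      push_cast
      ring

/-! ### Greedy steps and the progress of one epoch -/

theorem gain_eq (f : Finset (Fin n) → ℝ) (ε : ℝ) (x : Fin n → ℝ) (S : Finset (Fin n))
    (e : Fin n) : gain f ε x S e = ε * multilinear (diff f e) (x + ε • ind S) := by
  rw [gain, marginal, add_comm (ε • ind {e}), multilinear_add_smul]
  ring

theorem CanAdd.anti {M : Matroid (Fin n)} {S T : Finset (Fin n)} {e : Fin n} (h : CanAdd M T e)
    (hST : S ⊆ T) : CanAdd M S e :=
  ⟨fun he => h.1 (hST he), h.2.subset (Set.insert_subset_insert (Finset.coe_subset.2 hST))⟩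

section Step

variable (f : Finset (Fin n) → ℝ) (M : Matroid (Fin n)) (ε : ℝ)

theorem greedyStep_cases {pick : (T : Finset (Fin n)) → T.Nonempty → Fin n}
    (hpick : ∀ T hT, pick T hT ∈ T) (x : Fin n → ℝ) (V S : Finset (Fin n)) :
    (greedyStep f M ε pick x V S = S ∧ ∀ e ∈ candidates M V S, gain f ε x S e < 0) ∨
    ∃ s ∈ candidates M V S, greedyStep f M ε pick x V S = insert s S ∧ 0 ≤ gain f ε x S s ∧
      ∀ e ∈ candidates M V S, gain f ε x S e ≤ gain f ε x S s := by
  by_cases h : ∃ e ∈ candidates M V S, 0 ≤ gain f ε x S e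
  · right
    have hs := hpick _ (maximizers_nonempty h)
    obtain ⟨hc, hmax⟩ := Finset.mem_filter.1 hs
    refine ⟨_, hc, by rw [greedyStep, dif_pos h], ?_, hmax⟩
    obtain ⟨e, he, h0⟩ := h
    exact h0.trans (hmax e he)
  · left
    refine ⟨by rw [greedyStep, dif_neg h], fun e he => ?_⟩
    by_contra! h'
    exact h ⟨e, he, h'⟩

variable {f M ε}

theorem mem_candidates {V S : Finset (Fin n)} {e : Fin n} :
    e ∈ candidates M V S ↔ e ∈ V ∧ CanAdd M S e := by
  classical
  simp [candidates]

/-- The increase of the multi-linear extension in one step. -/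
noncomputable def stepGain (f : Finset (Fin n) → ℝ) (ε : ℝ) (x : Fin n → ℝ)
    (S S' : Finset (Fin n)) : ℝ :=
  marginal f (ε • (ind S' - ind S)) (x + ε • ind S)

theorem stepGain_eq (x : Fin n → ℝ) (S S' : Finset (Fin n)) :
    stepGain f ε x S S' = multilinear f (x + ε • ind S') - multilinear f (x + ε • ind S) := by
  rw [stepGain, marginal]
  congr 2
  rw [smul_sub]
  abel

theorem stepGain_self (x : Fin n → ℝ) (S : Finset (Fin n)) : stepGain f ε x S S = 0 := by
  rw [stepGain_eq, sub_self]

theorem stepGain_insert (x : Fin n → ℝ) {S : Finset (Fin n)} {s : Fin n} (hs : s ∉ S) :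
    stepGain f ε x S (insert s S) = gain f ε x S s := by
  rw [stepGain, ind_insert hs, add_sub_cancel_left, gain]

variable {pick : (T : Finset (Fin n)) → T.Nonempty → Fin n} (hpick : ∀ T hT, pick T hT ∈ T)
include hpick

theorem stepGain_greedyStep_nonneg (x : Fin n → ℝ) (V S : Finset (Fin n)) :
    0 ≤ stepGain f ε x S (greedyStep f M ε pick x V S) := by
  rcases greedyStep_cases f M ε hpick x V S with ⟨h, -⟩ | ⟨s, hs, h, h0, -⟩
  · rw [h, stepGain_self]
  · rwa [h, stepGain_insert x (mem_candidates.1 hs).2.1]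

theorem gain_le_stepGain_greedyStep (x : Fin n → ℝ) (V S : Finset (Fin n)) {e : Fin n}
    (he : e ∈ candidates M V S) :
    gain f ε x S e ≤ stepGain f ε x S (greedyStep f M ε pick x V S) := by
  rcases greedyStep_cases f M ε hpick x V S with ⟨h, h'⟩ | ⟨s, hs, h, -, h'⟩
  · rw [h, stepGain_self]
    exact (h' e he).le
  · rw [h, stepGain_insert x (mem_candidates.1 hs).2.1]
    exact h' e he

theorem greedyStep_props (x : Fin n → ℝ) (V S : Finset (Fin n)) :
    S ⊆ greedyStep f M ε pick x V S ∧ greedyStep f M ε pick x V S ⊆ S ∪ V ∧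
      (greedyStep f M ε pick x V S).card ≤ S.card + 1 ∧
      (M.Indep (S : Set (Fin n)) → M.Indep (greedyStep f M ε pick x V S : Set (Fin n))) := by
  rcases greedyStep_cases f M ε hpick x V S with ⟨h, -⟩ | ⟨s, hs, h, -, -⟩
  · rw [h]
    exact ⟨subset_rfl, Finset.subset_union_left, Nat.le_succ _, id⟩
  · rw [h]
    obtain ⟨hV, -, hi⟩ := mem_candidates.1 hs
    refine ⟨Finset.subset_insert _ _, ?_, Finset.card_insert_le _ _, fun _ => by simpa using hi⟩
    exact Finset.insert_subset (Finset.mem_union_right _ hV) Finset.subset_union_left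

end Step

section Epoch

variable {f : Finset (Fin n) → ℝ} {M : Matroid (Fin n)} {ε : ℝ}
  {pick : ℕ → (T : Finset (Fin n)) → T.Nonempty → Fin n} (hpick : ∀ i T hT, pick i T hT ∈ T)
  (x : Fin n → ℝ) (V : ℕ → Finset (Fin n))
include hpick

theorem epochSol_indep (i : ℕ) : M.Indep (epochSol f M ε pick x V i : Set (Fin n)) := by
  induction i with
  | zero => simp [epochSol]
  | succ i ih => exact (greedyStep_props (hpick i) x (V i) _).2.2.2 ih

theorem epochSol_card_le (i : ℕ) : (epochSol f M ε pick x V i).card ≤ i := by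
  induction i with
  | zero => simp [epochSol]
  | succ i ih =>
    exact ((greedyStep_props (hpick i) x (V i) _).2.2.1).trans (Nat.succ_le_succ ih)

theorem epochSol_mono : Monotone (epochSol f M ε pick x V) :=
  monotone_nat_of_le_succ fun i => (greedyStep_props (hpick i) x (V i) _).1

theorem epochSol_subset (i : ℕ) :
    epochSol f M ε pick x V i ⊆ (Finset.range i).biUnion V := by
  induction i with
  | zero => simp [epochSol]
  | succ i ih =>
    refine ((greedyStep_props (hpick i) x (V i) _).2.1).trans ?_
    rw [Finset.range_add_one, Finset.biUnion_insert, Finset.union_comm]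
    exact Finset.union_subset_union_right ih

omit hpick in
theorem sum_stepGain (r : ℕ) :
    ∑ i ∈ Finset.range r,
      stepGain f ε x (epochSol f M ε pick x V i) (epochSol f M ε pick x V (i + 1)) =
      multilinear f (x + ε • ind (epochSol f M ε pick x V r)) - multilinear f x := by
  simp only [stepGain_eq]
  rw [Finset.sum_range_sub (fun i => multilinear f (x + ε • ind (epochSol f M ε pick x V i)))]
  simp [epochSol, ind_empty]

omit hpick in
-- `A i` plays the role of the elements blocked at step `i`. Steps are filled from the last one
-- backwards: if `B` has `r + 1` elements, at most `r` of them are blocked at step `r`, so some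
-- element can take that step.
theorem exists_assignment {α : Type*} [DecidableEq α] (A : ℕ → Finset α) (r : ℕ)
    (B : Finset α) (hB : B.card ≤ r) (hAB : ∀ i, (A i ∩ B).card ≤ i) :
    ∃ π : α → ℕ, (∀ o ∈ B, π o < r ∧ o ∉ A (π o)) ∧ Set.InjOn π B := by
  induction r generalizing B with
  | zero =>
    have : B = ∅ := by simpa using hB
    subst this
    exact ⟨fun _ => 0, by simp, by simp⟩
  | succ r ih =>
    rcases Nat.lt_or_ge r B.card with h | h
    · obtain ⟨b, hb, hbA⟩ : ∃ b ∈ B, b ∉ A r := by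
        by_contra! hcon
        have : A r ∩ B = B := Finset.inter_eq_right.2 hcon
        have := hAB r
        grind
      obtain ⟨π, hπ, hinj⟩ := ih (B.erase b) (by rw [Finset.card_erase_of_mem hb]; omega)
        (fun i => (Finset.card_le_card
          (Finset.inter_subset_inter_left (Finset.erase_subset b B))).trans (hAB i))
      refine ⟨Function.update π b r, fun o ho => ?_, fun o ho o' ho' hoo => ?_⟩
      · by_cases hob : o = b
        · subst hob; simpa using hbA
        · have := hπ o (Finset.mem_erase.2 ⟨hob, ho⟩)
          simp only [Function.update_of_ne hob]
          exact ⟨by omega, this.2⟩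
      · by_cases hob : o = b <;> by_cases hob' : o' = b
        · rw [hob, hob']
        · have := hπ o' (Finset.mem_erase.2 ⟨hob', ho'⟩)
          rw [hob, Function.update_self, Function.update_of_ne hob'] at hoo
          omega
        · have := hπ o (Finset.mem_erase.2 ⟨hob, ho⟩)
          rw [hob', Function.update_self, Function.update_of_ne hob] at hoo
          omega
        · rw [Function.update_of_ne hob', Function.update_of_ne hob] at hoo
          exact hinj (Finset.mem_coe.2 (Finset.mem_erase.2 ⟨hob, ho⟩))
            (Finset.mem_coe.2 (Finset.mem_erase.2 ⟨hob', ho'⟩)) hoo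
    · obtain ⟨π, hπ, hinj⟩ := ih B h hAB
      exact ⟨π, fun o ho => ⟨(hπ o ho).1.trans (Nat.lt_succ_self r), (hπ o ho).2⟩, hinj⟩

omit hpick in
open Classical in
-- Elements that cannot be added lie in the closure of `S`, whose rank is `|S|`.
theorem card_filter_not_canAdd_le (hE : M.E = Set.univ) {S B : Finset (Fin n)}
    (hS : M.Indep (S : Set (Fin n))) (hB : M.Indep (B : Set (Fin n))) :
    (Finset.univ.filter (fun e => ¬ CanAdd M S e) ∩ B).card ≤ S.card := by
  have hsub : ((Finset.univ.filter (fun e => ¬ CanAdd M S e) ∩ B : Finset (Fin n)) :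
      Set (Fin n)) ⊆ M.closure S := by
    intro e he
    have he' : ¬ CanAdd M S e := by
      have := Finset.mem_coe.1 he
      simp only [Finset.mem_inter, Finset.mem_filter] at this
      exact this.1.2
    rw [hS.mem_closure_iff']
    refine ⟨hE ▸ Set.mem_univ e, fun h => ?_⟩
    by_contra h'
    exact he' ⟨h', h⟩
  have hind : M.Indep ((Finset.univ.filter (fun e => ¬ CanAdd M S e) ∩ B : Finset (Fin n)) :
      Set (Fin n)) := hB.subset (Finset.coe_subset.2 Finset.inter_subset_right)
  have h := hind.encard_le_eRk_of_subset hsub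
  rw [M.eRk_closure_eq, hS.eRk_eq_encard, Set.encard_coe_eq_coe_finsetCard,
    Set.encard_coe_eq_coe_finsetCard] at h
  exact_mod_cast h

/-- The derivative in direction `o` at the end of the epoch is at most the one at the step assigned
to `o`, where `hgain` compares it with the greedy increase. Distinct steps make these increases
telescope; since increases are non-negative, unassigned steps and negative derivatives do no harm.
-/
theorem IsSubmodular.epoch_progress (hf : IsSubmodular f) (hE : M.E = Set.univ) (hε : 0 ≤ ε)
    (h0 : 0 ≤ x) (h1 : ∀ i, x i + ε ≤ 1) {r : ℕ} {B : Finset (Fin n)}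
    (hB : M.Indep (B : Set (Fin n))) (hBr : B.card ≤ r) {m : ℝ} (hm : 0 ≤ m)
    (hgain : ∀ i < r, ∀ o ∈ B, CanAdd M (epochSol f M ε pick x V i) o →
      gain f ε x (epochSol f M ε pick x V i) o ≤ (1 + ε) *
        (stepGain f ε x (epochSol f M ε pick x V i) (epochSol f M ε pick x V (i + 1)) + m)) :
    ε * (multilinear f (fun i => if i ∈ B then 1 else
        (x + ε • ind (epochSol f M ε pick x V r)) i) -
        multilinear f (x + ε • ind (epochSol f M ε pick x V r))) ≤
      (1 + ε) * (multilinear f (x + ε • ind (epochSol f M ε pick x V r)) - multilinear f x +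
        r * m) := by
  classical
  set S := epochSol f M ε pick x V with hS
  have hz0 : ∀ i, 0 ≤ x + ε • ind (S i) := fun i => add_nonneg h0 (smul_nonneg hε (ind_nonneg _))
  have hz1 : ∀ i, x + ε • ind (S i) ≤ 1 := by
    intro i e
    have := mul_le_mul_of_nonneg_left (ind_le_one (S i) e) hε
    have := h1 e
    simp only [Pi.add_apply, Pi.smul_apply, smul_eq_mul, Pi.one_apply] at *
    linarith
  have hδ : ∀ i, 0 ≤ stepGain f ε x (S i) (S (i + 1)) := fun i =>
    stepGain_greedyStep_nonneg (hpick i) x (V i) _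
  obtain ⟨π, hπ, hinj⟩ := exists_assignment
    (fun i => Finset.univ.filter (fun e => ¬ CanAdd M (S i) e)) r B hBr
    (fun i => (card_filter_not_canAdd_le hE (epochSol_indep hpick x V i) hB).trans
      (epochSol_card_le hpick x V i))
  have hjoin := hf.multilinear_join_le (hz0 r) (hz1 r) B
  have hterm : ∀ o ∈ B, ε * max (multilinear (diff f o) (x + ε • ind (S r))) 0 ≤
      (1 + ε) * (stepGain f ε x (S (π o)) (S (π o + 1)) + m) := by
    intro o ho
    obtain ⟨hlt, hcan⟩ := hπ o ho
    have hcan : CanAdd M (S (π o)) o := by simpa using hcan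
    have h2 := hgain (π o) hlt o ho hcan
    rw [gain_eq] at h2
    rw [mul_max_of_nonneg _ _ hε, mul_zero]
    refine max_le (le_trans (mul_le_mul_of_nonneg_left ?_ hε) h2) ?_
    · refine hf.multilinear_diff_antitone o (hz0 _) ?_ (hz1 r)
      exact add_le_add le_rfl
        (smul_le_smul_of_nonneg_left (ind_mono (epochSol_mono hpick x V hlt.le)) hε)
    · have := hδ (π o)
      positivity
  have hsum : ∑ o ∈ B, (stepGain f ε x (S (π o)) (S (π o + 1)) + m) ≤
      ∑ i ∈ Finset.range r, (stepGain f ε x (S i) (S (i + 1)) + m) := by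
    rw [← Finset.sum_image (f := fun i => stepGain f ε x (S i) (S (i + 1)) + m) hinj]
    refine Finset.sum_le_sum_of_subset_of_nonneg ?_ fun i _ _ => add_nonneg (hδ i) hm
    intro i hi
    obtain ⟨o, ho, rfl⟩ := Finset.mem_image.1 hi
    exact Finset.mem_range.2 (hπ o ho).1
  have htel : ∑ i ∈ Finset.range r, (stepGain f ε x (S i) (S (i + 1)) + m) =
      multilinear f (x + ε • ind (S r)) - multilinear f x + r * m := by
    rw [Finset.sum_add_distrib, sum_stepGain x V r, Finset.sum_const, Finset.card_range,
      nsmul_eq_mul]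
  rw [htel] at hsum
  calc _ ≤ ε * ∑ e ∈ B, max (multilinear (diff f e) (x + ε • ind (S r))) 0 :=
        mul_le_mul_of_nonneg_left (by linarith) hε
    _ = ∑ e ∈ B, ε * max (multilinear (diff f e) (x + ε • ind (S r))) 0 := Finset.mul_sum _ _ _
    _ ≤ ∑ o ∈ B, (1 + ε) * (stepGain f ε x (S (π o)) (S (π o + 1)) + m) :=
        Finset.sum_le_sum hterm
    _ = (1 + ε) * ∑ o ∈ B, (stepGain f ε x (S (π o)) (S (π o + 1)) + m) :=
        (Finset.mul_sum _ _ _).symm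
    _ ≤ _ := mul_le_mul_of_nonneg_left hsum (by linarith)

end Epoch

/-! ### Rounding to the grid -/

section Grid

theorem le_roundDown {I : Finset ℝ} (hI : I.Nonempty) {a b : ℝ} (hb : b ∈ I) (hba : b ≤ a) :
    b ≤ roundDown I hI a := by
  have h : b ∈ I.filter (fun i => i ≤ a) := Finset.mem_filter.2 ⟨hb, hba⟩
  rw [roundDown, dif_pos ⟨b, h⟩]
  exact Finset.le_max' _ _ h

theorem roundDown_mem {I : Finset ℝ} (hI : I.Nonempty) (a : ℝ) : roundDown I hI a ∈ I := by
  unfold roundDown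
  split_ifs with h
  · exact (Finset.mem_filter.1 (Finset.max'_mem _ h)).1
  · exact Finset.min'_mem _ _

theorem roundDown_le_or {I : Finset ℝ} (hI : I.Nonempty) (a : ℝ) :
    roundDown I hI a ≤ a ∨ ∀ b ∈ I, roundDown I hI a ≤ b := by
  unfold roundDown
  split_ifs with h
  · exact Or.inl (Finset.mem_filter.1 (Finset.max'_mem _ h)).2
  · exact Or.inr fun b hb => Finset.min'_le _ _ hb

theorem mem_grid_zero (r : ℕ) (ε v : ℝ) : ε ^ 2 * v / r ∈ grid r ε v :=
  Finset.mem_image.2 ⟨0, by simp, by simp⟩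

/-- Consecutive grid points differ by a factor `1 + ε`, and the grid reaches up to at least `ε v ≥
a`. Rounding therefore costs this factor, plus the least grid point for values below the grid. -/
theorem le_of_roundDown_grid_le {r : ℕ} (hr : 0 < r) {ε v : ℝ} (hε : 0 < ε) (hv : 0 ≤ v)
    {a δ : ℝ} (ha : a ≤ ε * v) (hδ : 0 ≤ δ)
    (h : roundDown (grid r ε v) (grid_nonempty r ε v) a ≤
      roundDown (grid r ε v) (grid_nonempty r ε v) δ) :
    a ≤ (1 + ε) * (δ + ε ^ 2 * v / r) := by
  have hr' : (0 : ℝ) < r := by exact_mod_cast hr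
  set m := ε ^ 2 * v / r with hm
  have hm0 : 0 ≤ m := by positivity
  have hup : roundDown (grid r ε v) (grid_nonempty r ε v) δ ≤ δ + m := by
    rcases roundDown_le_or (grid_nonempty r ε v) δ with h' | h'
    · linarith
    · linarith [h' _ (mem_grid_zero r ε v)]
  rcases le_or_gt a m with ham | ham
  · have : 0 ≤ δ + ε * (δ + m) := by positivity
    linarith
  set K := ⌈Real.logb (1 + ε) (r / ε)⌉₊ with hK
  have htop : a ≤ (1 + ε) ^ K * m := by
    have h1 : (r : ℝ) / ε ≤ (1 + ε) ^ K := by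
      have h2 : Real.logb (1 + ε) (r / ε) ≤ K := Nat.le_ceil _
      rw [Real.logb_le_iff_le_rpow (by linarith) (by positivity), Real.rpow_natCast] at h2
      exact h2
    calc a ≤ ε * v := ha
      _ = r / ε * m := by rw [hm]; field_simp
      _ ≤ _ := mul_le_mul_of_nonneg_right h1 hm0
  classical
  -- The least such `k` is positive, and `k - 1` indexes a grid point below `a` that is within a
  -- factor `1 + ε` of it.
  have hex : ∃ k, a ≤ (1 + ε) ^ k * m := ⟨K, htop⟩
  obtain ⟨j, hj⟩ : ∃ j, Nat.find hex = j + 1 := by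
    refine Nat.exists_eq_succ_of_ne_zero fun h0 => ?_
    have := Nat.find_spec hex
    rw [h0, pow_zero, one_mul] at this
    linarith
  have hjlt : (1 + ε) ^ j * m < a := not_le.1 (Nat.find_min hex (by omega))
  have hjK : j < K := by
    have := Nat.find_min' hex htop
    omega
  have hle := Nat.find_spec hex
  rw [hj] at hle
  have hmem : (1 + ε) ^ j * m ∈ grid r ε v :=
    Finset.mem_image.2 ⟨j, Finset.mem_range.2 (by omega), rfl⟩
  have := le_roundDown (grid_nonempty r ε v) hmem hjlt.le
  calc a ≤ (1 + ε) * ((1 + ε) ^ j * m) := by rw [← mul_assoc, ← pow_succ']; exact hle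
    _ ≤ _ := mul_le_mul_of_nonneg_left (by linarith) (by linarith)

end Grid

/-! ### The recurrence over epochs, and the value of joining with `O \ H` -/

theorem le_maxSingleton (f : Finset (Fin n) → ℝ) (e : Fin n) : f {e} ≤ maxSingleton f :=
  le_ciSup (f := fun e : Fin n => f {e}) (Set.finite_range _).bddAbove e

theorem one_sub_inv_exp_mul_le {N : ℕ} {ε : ℝ} (hε0 : 0 < ε) (hε : ε < 1 / 4) (hN : N * ε = 1)
    {a c : ℝ} (hc : 0 ≤ c) (hac : a ≤ c) (F : ℕ → ℝ) (hF0 : 0 ≤ F 0) (hFN : 0 ≤ F N)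
    (hF : ∀ t < N, ε * (a - ε * c - F (t + 1)) ≤ (1 + ε) * (F (t + 1) - F t + ε ^ 2 * c)) :
    (1 - 1 / Real.exp 1) * (a - 8 * ε * c) ≤ F N := by
  have hE2 : 1 / Real.exp 1 ≤ 1 / 2 := by
    have := Real.add_one_le_exp (1 : ℝ)
    exact one_div_le_one_div_of_le (by norm_num) (by linarith)
  have hE0 : 0 < 1 / Real.exp 1 := by positivity
  set E := 1 / Real.exp 1 with hE
  rcases lt_or_ge (a - 8 * ε * c) 0 with hneg | hpos
  · exact (mul_nonpos_of_nonneg_of_nonpos (by linarith) hneg.le).trans hFN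
  -- `W` absorbs both error terms: the recurrence becomes `(1 + 2ε)(W - F (t+1)) ≤ (1 + ε)(W - F
  -- t)`, a contraction by `ρ`.
  set W := a - ε * c - ε * (1 + ε) * c with hW
  have hεc : 0 ≤ ε * c := by positivity
  have hεεc : ε * (ε * c) ≤ 1 / 4 * (ε * c) := mul_le_mul_of_nonneg_right hε.le hεc
  have hW0 : 0 ≤ W := by rw [hW]; nlinarith
  have hWc : W ≤ c := by rw [hW]; nlinarith
  set ρ := 1 - ε / (1 + 2 * ε) with hρ
  have hρ' : ρ = (1 + ε) / (1 + 2 * ε) := by rw [hρ]; field_simp; ring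
  have hρ0 : 0 ≤ ρ := by rw [hρ']; positivity
  have hstep : ∀ t ≤ N, W - F t ≤ ρ ^ t * W := by
    intro t
    induction t with
    | zero => intro _; simpa using hF0
    | succ t ih =>
      intro ht
      have h1 := ih (by omega)
      have h2 := hF t (by omega)
      have h3 : (W - F (t + 1)) * (1 + 2 * ε) ≤ (1 + ε) * (W - F t) := by
        rw [hW]; nlinarith
      have h4 : W - F (t + 1) ≤ ρ * (W - F t) := by
        rw [hρ', div_mul_eq_mul_div, le_div_iff₀ (by linarith)]
        exact h3
      calc W - F (t + 1) ≤ ρ * (W - F t) := h4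
        _ ≤ ρ * (ρ ^ t * W) := mul_le_mul_of_nonneg_left h1 hρ0
        _ = ρ ^ (t + 1) * W := by ring
  -- `ρ ^ N ≤ exp(-1/(1+2ε)) = e⁻¹ exp(2ε/(1+2ε))`, and the last factor is at most `1 + 2ε`.
  have hpow : ρ ^ N ≤ E * (1 + 2 * ε) := by
    have h1 : ρ ≤ Real.exp (-(ε / (1 + 2 * ε))) := by
      have := Real.add_one_le_exp (-(ε / (1 + 2 * ε)))
      linarith
    have h2 : (N : ℝ) * -(ε / (1 + 2 * ε)) = -(1 / (1 + 2 * ε)) := by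
      rw [mul_neg, ← mul_div_assoc, hN]
    have h3 : ρ ^ N ≤ Real.exp (-(1 / (1 + 2 * ε))) := by
      rw [← h2, Real.exp_nat_mul]
      exact pow_le_pow_left₀ hρ0 h1 N
    refine h3.trans ?_
    have h4 : 1 / (1 + 2 * ε) ≤ Real.exp (-(2 * ε / (1 + 2 * ε))) := by
      have := Real.add_one_le_exp (-(2 * ε / (1 + 2 * ε)))
      have h5 : 1 / (1 + 2 * ε) = -(2 * ε / (1 + 2 * ε)) + 1 := by field_simp; ring
      linarith
    have h5 : Real.exp (-(1 / (1 + 2 * ε))) * Real.exp (-(2 * ε / (1 + 2 * ε))) = E := by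
      rw [← Real.exp_add, hE, one_div (Real.exp 1), ← Real.exp_neg]
      congr 1
      field_simp
      ring
    calc Real.exp (-(1 / (1 + 2 * ε)))
        = Real.exp (-(1 / (1 + 2 * ε))) * (1 / (1 + 2 * ε)) * (1 + 2 * ε) := by
          field_simp
      _ ≤ E * (1 + 2 * ε) := by
          rw [← h5]
          exact mul_le_mul_of_nonneg_right
            (mul_le_mul_of_nonneg_left h4 (Real.exp_pos _).le) (by linarith)
  have h1 := hstep N le_rfl
  have h2 := mul_le_mul_of_nonneg_right hpow hW0
  have h3 : ε * W ≤ ε * c := mul_le_mul_of_nonneg_left hWc hε0.le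
  have h4 : E * (ε * W) ≤ 1 / 2 * (ε * c) :=
    mul_le_mul hE2 h3 (by positivity) (by norm_num)
  -- What remains of the allowance `8ε` after the errors in `W` pays for the excess `2ε E W ≤ ε c`
  -- in `hpow`.
  have h5 : 1 / 2 * (5 * (ε * c)) ≤ (1 - E) * (8 * ε * c - ε * c - ε * (1 + ε) * c) :=
    mul_le_mul (by linarith) (by nlinarith) (by positivity) (by linarith)
  have h6 : (1 - E) * (a - 8 * ε * c) =
      (1 - E) * W - (1 - E) * (8 * ε * c - ε * c - ε * (1 + ε) * c) := by rw [hW]; ring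
  nlinarith

/-- Submodularity for `S` and `O` gives `f S ≥ f (S ∩ O) - (f O - c)`. The set `S ∩ O` may contain
part of `H`; submodularity for it and `O \ (S ∩ H)`, whose value is at most `f O` by optimality,
gives `f (S ∩ O) ≥ f (O \ H)`. -/
theorem IsOptimal.le_of_between {f : Finset (Fin n) → ℝ} (hf : IsSubmodular f)
    {M : Matroid (Fin n)} {O : Finset (Fin n)} (hO : IsOptimal f M O) {H U : Finset (Fin n)}
    {c : ℝ} (hU : ∀ T ⊆ U, c ≤ f (O ∪ T)) {S : Finset (Fin n)} (h1 : O \ H ⊆ S)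
    (h2 : S ⊆ U ∪ O \ H) : f (O \ H) - (f O - c) ≤ f S := by
  have hs := hf.union_add_inter_le S O
  have ht := hf.union_add_inter_le (S ∩ O) (O \ (S ∩ H))
  have e1 : S ∪ O = O ∪ (S ∩ U) := by
    ext i
    have := @h2 i
    simp only [Finset.mem_union, Finset.mem_inter, Finset.mem_sdiff] at *
    tauto
  have e2 : S ∩ O ∪ O \ (S ∩ H) = O := by
    ext i
    have := @h1 i
    simp only [Finset.mem_union, Finset.mem_inter, Finset.mem_sdiff] at *
    tauto
  have e3 : S ∩ O ∩ (O \ (S ∩ H)) = O \ H := by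
    ext i
    have := @h1 i
    simp only [Finset.mem_inter, Finset.mem_sdiff] at *
    tauto
  rw [e1] at hs
  rw [e2, e3] at ht
  have h3 := hU (S ∩ U) Finset.inter_subset_right
  have h4 := hO.2 (O \ (S ∩ H)) (hO.1.subset (Finset.coe_subset.2 Finset.sdiff_subset))
  linarith

theorem IsOptimal.le_multilinear_join {f : Finset (Fin n) → ℝ} (hf : IsSubmodular f)
    {M : Matroid (Fin n)} {O : Finset (Fin n)} (hO : IsOptimal f M O) {H U : Finset (Fin n)}
    {c : ℝ} (hU : ∀ T ⊆ U, c ≤ f (O ∪ T)) {y : Fin n → ℝ} (h0 : 0 ≤ y) (h1 : y ≤ 1)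
    (hy : ∀ e ∉ U, y e = 0) :
    f (O \ H) - (f O - c) ≤ multilinear f (fun i => if i ∈ O \ H then 1 else y i) := by
  refine le_multilinear (fun i => ?_) (fun i => ?_) fun S hS1 hS2 => ?_
  · have := h0 i; dsimp only; split_ifs <;> simp_all
  · have := h1 i; dsimp only; split_ifs <;> simp_all
  · refine hO.le_of_between hf hU (fun e he => hS1 e (if_pos he)) fun e he => ?_
    by_contra hcon
    rw [Finset.mem_union, not_or] at hcon
    exact hS2 e (by rw [if_neg hcon.2, hy e hcon.1]) he

/-! ### Deterministic guarantee and size of the filtered set -/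

section Algorithm

variable (f : Finset (Fin n) → ℝ) (M : Matroid (Fin n)) (r : ℕ) (ε : ℝ) (tie : TieBreak n)
  (V : ℕ → ℕ → Finset (Fin n))

theorem fracSol_eq_sum (t : ℕ) : fracSol f M r ε tie V t =
    ∑ s ∈ Finset.range t, ε • ind (intSol f M r ε tie V s r) := by
  induction t with
  | zero => simp [fracSol]
  | succ t ih => rw [Finset.sum_range_succ, ← ih]; rfl

variable {ε}

theorem fracSol_nonneg (hε : 0 ≤ ε) (t : ℕ) : 0 ≤ fracSol f M r ε tie V t := by
  rw [fracSol_eq_sum]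
  exact Finset.sum_nonneg fun s _ => smul_nonneg hε (ind_nonneg _)

theorem fracSol_le (hε : 0 ≤ ε) (t : ℕ) (e : Fin n) : fracSol f M r ε tie V t e ≤ t * ε := by
  rw [fracSol_eq_sum, Finset.sum_apply]
  refine (Finset.sum_le_card_nsmul _ _ ε fun s _ => ?_).trans_eq (by simp)
  have := mul_le_mul_of_nonneg_left (ind_le_one (intSol f M r ε tie V s r) e) hε
  simpa using this

variable {f M r tie V}

/-- The performance guarantee for a run in which all elements that should be filtered are. -/
theorem multilinear_fracSol_ge (hf0 : ∀ X, 0 ≤ f X) (hf : IsSubmodular f) (hE : M.E = Set.univ)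
    (hr : M.eRank = r) (hr0 : 0 < r) (hε0 : 0 < ε) (hε : ε < 1 / 4) {N : ℕ} (hN : N * ε = 1)
    {O : Finset (Fin n)} (hO : IsOptimal f M O) (hv : maxSingleton f ≤ f O)
    {H : Finset (Fin n)} (hH : ∀ o ∈ O \ H, ¬ PassesFilter f M r N ε tie V o)
    (hU : ∀ T ⊆ (Finset.range N).biUnion (fun t => (Finset.range r).biUnion (V t)),
      (1 - ε) * f O ≤ f (O ∪ T)) :
    (1 - 1 / Real.exp 1) * (f (O \ H) - 8 * ε * f O) ≤
      multilinear f (fracSol f M r ε tie V N) := by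
  have hr' : (0 : ℝ) < r := by exact_mod_cast hr0
  have hOH : M.Indep ((O \ H : Finset (Fin n)) : Set (Fin n)) :=
    hO.1.subset (Finset.coe_subset.2 Finset.sdiff_subset)
  have hcard : (O \ H).card ≤ r := by
    have := hOH.encard_le_eRank
    rw [hr, Set.encard_coe_eq_coe_finsetCard] at this
    exact_mod_cast this
  have hv0 : 0 ≤ maxSingleton f := Real.iSup_nonneg fun e => hf0 _
  have hx1 : ∀ t ≤ N, fracSol f M r ε tie V t ≤ 1 := by
    intro t ht e
    refine (fracSol_le f M r tie V hε0.le t e).trans ?_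
    have : (t : ℝ) ≤ N := by exact_mod_cast ht
    calc (t : ℝ) * ε ≤ N * ε := mul_le_mul_of_nonneg_right this hε0.le
      _ = 1 := hN
  have hF : ∀ t ≤ N, 0 ≤ multilinear f (fracSol f M r ε tie V t) := fun t ht =>
    multilinear_nonneg hf0 (fracSol_nonneg f M r tie V hε0.le t) (hx1 t ht)
  refine one_sub_inv_exp_mul_le hε0 hε hN (hf0 O) (hO.2 _ hOH)
    (fun t => multilinear f (fracSol f M r ε tie V t)) (hF 0 (Nat.zero_le _)) (hF N le_rfl)
    fun t ht => ?_
  have hxt : ∀ i, fracSol f M r ε tie V t i + ε ≤ 1 := by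
    intro i
    have h1 := fracSol_le f M r tie V hε0.le t i
    have h2 : ((t + 1 : ℕ) : ℝ) ≤ N := by exact_mod_cast ht
    have h3 := mul_le_mul_of_nonneg_right h2 hε0.le
    push_cast at h3
    linarith
  have hz1 : ∀ S, fracSol f M r ε tie V t + ε • ind S ≤ 1 := by
    intro S e
    have := mul_le_mul_of_nonneg_left (ind_le_one S e) hε0.le
    have := hxt e
    simp only [Pi.add_apply, Pi.smul_apply, smul_eq_mul, Pi.one_apply] at *
    linarith
  have hz0 : ∀ S, 0 ≤ fracSol f M r ε tie V t + ε • ind S := fun S =>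
    add_nonneg (fracSol_nonneg f M r tie V hε0.le t) (smul_nonneg hε0.le (ind_nonneg _))
  have hprog := hf.epoch_progress (pick := tie.pick t) (tie.pick_mem t)
    (fracSol f M r ε tie V t) (V t) hE hε0.le (fracSol_nonneg f M r tie V hε0.le t) hxt hOH hcard
    (m := ε ^ 2 * maxSingleton f / r) (by positivity) (fun i hi o ho hcan => by
      refine le_of_roundDown_grid_le hr0 hε0 hv0 ?_
        (stepGain_greedyStep_nonneg (tie.pick_mem t i) _ _ _) ?_
      · rw [gain_eq]
        refine mul_le_mul_of_nonneg_left ?_ hε0.le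
        have := hf.multilinear_diff_le o (hz0 (epochSol f M ε (tie.pick t)
          (fracSol f M r ε tie V t) (V t) i)) (hz1 _)
        linarith [hf0 ∅, le_maxSingleton f o]
      · by_contra! hlt
        exact hH o ho ⟨t, ht, i, hi, hcan, hlt⟩)
  have hx : fracSol f M r ε tie V (t + 1) = fracSol f M r ε tie V t +
      ε • ind (epochSol f M ε (tie.pick t) (fracSol f M r ε tie V t) (V t) r) := rfl
  have hjoin := hO.le_multilinear_join hf (H := H) hU
    (fracSol_nonneg f M r tie V hε0.le (t + 1)) (hx1 _ ht) (fun e he => by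
      rw [fracSol_eq_sum, Finset.sum_apply]
      refine Finset.sum_eq_zero fun s hs => ?_
      have : e ∉ intSol f M r ε tie V s r := fun h => he (Finset.mem_biUnion.2
        ⟨s, Finset.mem_range.2 ((Finset.mem_range.1 hs).trans_le ht),
          epochSol_subset (tie.pick_mem s) _ _ _ h⟩)
      simp [ind, this])
  have e1 : (r : ℝ) * (ε ^ 2 * maxSingleton f / r) = ε ^ 2 * maxSingleton f := by field_simp
  rw [← hx, e1] at hprog
  refine le_trans (mul_le_mul_of_nonneg_left (by linarith) hε0.le)
    (hprog.trans (mul_le_mul_of_nonneg_left ?_ (by linarith)))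
  have := mul_le_mul_of_nonneg_left hv (sq_nonneg ε)
  linarith

/-- The elements that can be added in step `i` of epoch `t` with a gain of at least `τ`. -/
def addable (f : Finset (Fin n) → ℝ) (M : Matroid (Fin n)) (r : ℕ) (ε : ℝ) (tie : TieBreak n)
    (V : ℕ → ℕ → Finset (Fin n)) (t i : ℕ) (τ : ℝ) : Set (Fin n) :=
  {j | CanAdd M (intSol f M r ε tie V t i) j ∧
    τ ≤ gain f ε (fracSol f M r ε tie V t) (intSol f M r ε tie V t i) j}

/-- Every sample meets all sets of addable elements of large gain with more than `k` elements. -/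
def HitsLarge (f : Finset (Fin n) → ℝ) (M : Matroid (Fin n)) (r : ℕ) (ε : ℝ) (tie : TieBreak n)
    (V : ℕ → ℕ → Finset (Fin n)) (k : ℝ) (t i : ℕ) : Prop :=
  ∀ τ, k < (addable f M r ε tie V t i τ).ncard → ∃ e ∈ V t i, e ∈ addable f M r ε tie V t i τ

/-- Within an epoch the solution only grows, so both addability and gains can only be lost. -/
theorem addable_anti (hf : IsSubmodular f) (hε0 : 0 ≤ ε) {N : ℕ} (hN : N * ε = 1) {t i j : ℕ}
    (ht : t < N) (hij : i ≤ j) (τ : ℝ) :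
    addable f M r ε tie V t j τ ⊆ addable f M r ε tie V t i τ := by
  rintro e ⟨hcan, hτ⟩
  have hmono : intSol f M r ε tie V t i ⊆ intSol f M r ε tie V t j :=
    epochSol_mono (tie.pick_mem t) _ _ hij
  refine ⟨hcan.anti hmono, hτ.trans ?_⟩
  rw [gain_eq, gain_eq]
  refine mul_le_mul_of_nonneg_left (hf.multilinear_diff_antitone e ?_ ?_ ?_) hε0
  · exact add_nonneg (fracSol_nonneg f M r tie V hε0 t) (smul_nonneg hε0 (ind_nonneg _))
  · exact add_le_add le_rfl (smul_le_smul_of_nonneg_left (ind_mono hmono) hε0)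
  · intro e
    have h1 := fracSol_le f M r tie V hε0 t e
    have h2 : ((t + 1 : ℕ) : ℝ) ≤ N := by exact_mod_cast ht
    have h3 := mul_le_mul_of_nonneg_right h2 hε0
    have := mul_le_mul_of_nonneg_left (ind_le_one (intSol f M r ε tie V t j) e) hε0
    push_cast at h3
    simp only [Pi.add_apply, Pi.smul_apply, smul_eq_mul, Pi.one_apply] at *
    linarith

/-- The threshold is the rounded gain of `j`. A sampled addable element reaching it would push the
rounded greedy increase up to it as well. -/
theorem exists_addable_of_passesFilter {N : ℕ}
    {j : Fin n} (hj : PassesFilter f M r N ε tie V j) :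
    ∃ t < N, ∃ τ ∈ grid r ε (maxSingleton f), ∃ i < r, j ∈ addable f M r ε tie V t i τ ∧
      ∀ e ∈ V t i, e ∉ addable f M r ε tie V t i τ := by
  obtain ⟨t, ht, i, hi, hcan, hlt⟩ := hj
  have hI := grid_nonempty r ε (maxSingleton f)
  refine ⟨t, ht, roundDown (grid r ε (maxSingleton f)) hI
    (gain f ε (fracSol f M r ε tie V t) (intSol f M r ε tie V t i) j), roundDown_mem hI _, i, hi,
    ⟨hcan, ?_⟩, fun e he hadd => ?_⟩
  · refine (roundDown_le_or hI _).resolve_right fun h => ?_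
    exact absurd hlt (not_lt.2 (h _ (roundDown_mem hI _)))
  · have h1 := gain_le_stepGain_greedyStep (f := f) (ε := ε) (tie.pick_mem t i)
      (fracSol f M r ε tie V t) (V t i)
      (intSol f M r ε tie V t i) (mem_candidates.2 ⟨he, hadd.1⟩)
    have h2 := le_roundDown hI (roundDown_mem hI _) (hadd.2.trans h1)
    exact absurd hlt (not_lt.2 h2)

open Classical in
theorem card_passesFilter_le (hf : IsSubmodular f) (hε0 : 0 ≤ ε) {N : ℕ}
    (hN : N * ε = 1) {k : ℝ} (hk : 0 ≤ k)
    (hhit : ∀ t < N, ∀ i < r, HitsLarge f M r ε tie V k t i) :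
    ((Finset.univ.filter (PassesFilter f M r N ε tie V)).card : ℝ) ≤
      N * ((grid r ε (maxSingleton f)).card * k) := by
  set B : ℕ → ℝ → Finset (Fin n) := fun t τ => Finset.univ.filter fun j => ∃ i < r,
    j ∈ addable f M r ε tie V t i τ ∧ ∀ e ∈ V t i, e ∉ addable f M r ε tie V t i τ with hB
  have hBcard : ∀ t < N, ∀ τ, ((B t τ).card : ℝ) ≤ k := by
    intro t ht τ
    by_cases hex : ∃ i, i < r ∧ ∀ e ∈ V t i, e ∉ addable f M r ε tie V t i τ
    · obtain ⟨hi, hmiss⟩ := Nat.find_spec hex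
      -- All witnesses for `(t, τ)` were already addable at the first step whose sample missed them;
      -- a missed set has at most `k` elements.
      have hsub : (B t τ : Set (Fin n)) ⊆ addable f M r ε tie V t (Nat.find hex) τ := by
        intro j hj
        obtain ⟨i', hi', hj', hmiss'⟩ := (Finset.mem_filter.1 (Finset.mem_coe.1 hj)).2
        exact addable_anti hf hε0 hN ht (Nat.find_min' hex ⟨hi', hmiss'⟩) τ hj'
      have h1 := Set.ncard_le_ncard hsub (Set.toFinite _)
      rw [Set.ncard_coe_finset] at h1
      have h2 : ((addable f M r ε tie V t (Nat.find hex) τ).ncard : ℝ) ≤ k := by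
        by_contra! hlt
        obtain ⟨e, he, he'⟩ := hhit t ht _ hi τ hlt
        exact hmiss e he he'
      exact le_trans (by exact_mod_cast h1) h2
    · have : B t τ = ∅ := by
        refine Finset.filter_eq_empty_iff.2 fun j _ => ?_
        rintro ⟨i, hi, -, h⟩
        exact hex ⟨i, hi, h⟩
      simpa [this] using hk
  have hsub : Finset.univ.filter (PassesFilter f M r N ε tie V) ⊆
      (Finset.range N).biUnion fun t => (grid r ε (maxSingleton f)).biUnion fun τ => B t τ := by
    intro j hj
    obtain ⟨t, ht, τ, hτ, i, hi, h⟩ :=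
      exists_addable_of_passesFilter (Finset.mem_filter.1 hj).2
    exact Finset.mem_biUnion.2 ⟨t, Finset.mem_range.2 ht, Finset.mem_biUnion.2 ⟨τ, hτ,
      Finset.mem_filter.2 ⟨Finset.mem_univ _, i, hi, h⟩⟩⟩
  calc ((Finset.univ.filter (PassesFilter f M r N ε tie V)).card : ℝ)
      ≤ ∑ t ∈ Finset.range N, ∑ τ ∈ grid r ε (maxSingleton f), ((B t τ).card : ℝ) := by
        exact_mod_cast (Finset.card_le_card hsub).trans (Finset.card_biUnion_le.trans
          (Finset.sum_le_sum fun t _ => Finset.card_biUnion_le))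
    _ ≤ ∑ t ∈ Finset.range N, ∑ τ ∈ grid r ε (maxSingleton f), k :=
        Finset.sum_le_sum fun t ht => Finset.sum_le_sum fun τ _ =>
          hBcard t (Finset.mem_range.1 ht) τ
    _ = _ := by simp

open Classical in
-- The loop stops early only when `bound` is strictly exceeded, which a subset of the elements
-- satisfying `P` never does.
theorem filterLoop_eq (P : Fin n → Prop) {bound : ℝ}
    (hP : ((Finset.univ.filter P).card : ℝ) ≤ bound) (l : List (Fin n)) (H : Finset (Fin n))
    (hH : H ⊆ Finset.univ.filter P) :
    filterLoop P bound l H = H ∪ l.toFinset.filter P := by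
  induction l generalizing H with
  | nil => simp [filterLoop]
  | cons j l ih =>
    have hH' : (if P j then insert j H else H) ⊆ Finset.univ.filter P := by
      split_ifs with h
      · exact Finset.insert_subset (by simpa using h) hH
      · exact hH
    have hle : ((if P j then insert j H else H).card : ℝ) ≤ bound :=
      le_trans (by exact_mod_cast Finset.card_le_card hH') hP
    rw [filterLoop, if_neg (not_lt.2 (by convert hle))]
    refine (ih _ (by convert hH')).trans ?_
    ext i
    split_ifs with h <;>
      simp only [List.toFinset_cons, Finset.mem_union, Finset.mem_filter, Finset.mem_insert,
        List.mem_toFinset] <;> grind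

end Algorithm

/-! ### Product distributions, conditioning and union bounds -/

section Resampling

/-- Under a product distribution, one coordinate can be sampled anew. -/
theorem sum_prod_mul_eq_resample {ι α : Type*} [Fintype ι] [DecidableEq ι] [Fintype α] {w : α → ℝ}
    (hw : ∑ a, w a = 1) (i : ι) (g : (ι → α) → ℝ) :
    ∑ V : ι → α, (∏ j, w (V j)) * g V =
      ∑ V : ι → α, (∏ j, w (V j)) * ∑ a, w a * g (Function.update V i a) := by
  -- Swapping coordinate `i` with an independent fresh copy preserves the joint weight.
  have hinv : Function.Involutive
      (fun q : (ι → α) × α => (Function.update q.1 i q.2, q.1 i)) := by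
    rintro ⟨V, a⟩
    simp
  have hprod : ∀ (V : ι → α) (a : α),
      (∏ j, w (Function.update V i a j)) * w (V i) = (∏ j, w (V j)) * w a := by
    intro V a
    rw [Fintype.prod_eq_mul_prod_compl i, Fintype.prod_eq_mul_prod_compl i (fun j => w (V j)),
      Function.update_self]
    have : ∏ j ∈ {i}ᶜ, w (Function.update V i a j) = ∏ j ∈ {i}ᶜ, w (V j) :=
      Finset.prod_congr rfl fun j hj => by
        rw [Function.update_of_ne (by simpa using hj)]
    rw [this]
    ring
  calc ∑ V : ι → α, (∏ j, w (V j)) * g V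
      = ∑ V : ι → α, ∑ a, (∏ j, w (V j)) * w a * g V := by
        refine Finset.sum_congr rfl fun V _ => ?_
        rw [← Finset.sum_mul, ← Finset.mul_sum, hw, mul_one]
    _ = ∑ q : (ι → α) × α, (∏ j, w (q.1 j)) * w q.2 * g q.1 :=
        (Fintype.sum_prod_type' fun (V : ι → α) a => (∏ j, w (V j)) * w a * g V).symm
    _ = ∑ q : (ι → α) × α, (∏ j, w (q.1 j)) * w q.2 * g (Function.update q.1 i q.2) := by
        refine (Equiv.sum_comp hinv.toPerm _).symm.trans (Finset.sum_congr rfl fun q _ => ?_)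
        simp only [Function.Involutive.coe_toPerm, hprod]
    _ = ∑ V : ι → α, ∑ a, (∏ j, w (V j)) * w a * g (Function.update V i a) :=
        Fintype.sum_prod_type' fun (V : ι → α) a => (∏ j, w (V j)) * w a * g (Function.update V i a)
    _ = _ := by
        refine Finset.sum_congr rfl fun V _ => ?_
        rw [Finset.mul_sum]
        exact Finset.sum_congr rfl fun a _ => mul_assoc _ _ _

/-- The probability of `S` when every element is included independently with probability `p`. -/
def setWeight (p : ℝ) (S : Finset (Fin n)) : ℝ := ∏ e, if e ∈ S then p else 1 - p

theorem setWeight_nonneg {p : ℝ} (h0 : 0 ≤ p) (h1 : p ≤ 1) (S : Finset (Fin n)) :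
    0 ≤ setWeight p S :=
  Finset.prod_nonneg fun e _ => by split_ifs <;> linarith

theorem sum_setWeight (p : ℝ) : ∑ S : Finset (Fin n), setWeight p S = 1 := by
  simp [setWeight, sum_prod_ite_mem]

theorem sum_setWeight_disjoint (p : ℝ) (A : Finset (Fin n)) :
    ∑ S : Finset (Fin n), setWeight p S * (if Disjoint S A then 1 else 0) = (1 - p) ^ A.card := by
  have h : ∀ S : Finset (Fin n), setWeight p S * (if Disjoint S A then 1 else 0) =
      ∏ e, (if e ∈ S then (if e ∈ A then 0 else p) else 1 - p) := by
    intro S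
    split_ifs with hd
    · rw [mul_one]
      refine Finset.prod_congr rfl fun e _ => ?_
      by_cases he : e ∈ S
      · simp [he, Finset.disjoint_left.1 hd he]
      · simp [he]
    · obtain ⟨e, he, heA⟩ := Finset.not_disjoint_iff.1 hd
      rw [mul_zero]
      exact (Finset.prod_eq_zero (Finset.mem_univ e) (by simp [he, heA])).symm
  simp_rw [h]
  rw [sum_prod_ite_mem (fun e => if e ∈ A then 0 else p) (fun _ => 1 - p)]
  have h2 : ∀ e : Fin n, (if e ∈ A then 0 else p) + (1 - p) = if e ∈ A then 1 - p else 1 := by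
    intro e; split_ifs <;> ring
  simp_rw [h2]
  rw [Finset.prod_ite_mem, Finset.univ_inter, Finset.prod_const]

theorem sum_setWeight_mem (p : ℝ) (j : Fin n) :
    ∑ S : Finset (Fin n), setWeight p S * (if j ∈ S then 1 else 0) = p := by
  have h := sum_setWeight_disjoint p {j}
  have h2 : ∀ S : Finset (Fin n), setWeight p S * (if j ∈ S then 1 else 0) =
      setWeight p S - setWeight p S * (if Disjoint S {j} then 1 else 0) := by
    intro S
    by_cases hj : j ∈ S <;> simp [hj]
  simp_rw [h2]
  rw [Finset.sum_sub_distrib, h, sum_setWeight]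
  simp

variable {N r : ℕ} {p : ℝ}

theorem sampleWeight_nonneg (h0 : 0 ≤ p) (h1 : p ≤ 1) (V : Samples n N r) :
    0 ≤ sampleWeight p V :=
  Finset.prod_nonneg fun t _ => Finset.prod_nonneg fun i _ => setWeight_nonneg h0 h1 (V t i)

/-- The samples after the one of step `i` of epoch `t` is replaced by `a`. -/
def resample (V : Samples n N r) (t : Fin N) (i : Fin r) (a : Finset (Fin n)) : Samples n N r :=
  Function.update V t (Function.update (V t) i a)

theorem sum_sampleWeight_mul_eq_resample (t : Fin N) (i : Fin r) (g : Samples n N r → ℝ) :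
    ∑ V, sampleWeight p V * g V =
      ∑ V, sampleWeight p V * ∑ a, setWeight p a * g (resample V t i a) := by
  set W : (Fin r → Finset (Fin n)) → ℝ := fun R => ∏ i, setWeight p (R i) with hW
  have hW1 : ∑ R, W R = 1 := by
    have h := Finset.sum_prod_piFinset (Finset.univ : Finset (Finset (Fin n)))
      (fun (_ : Fin r) S => setWeight p S)
    rw [Fintype.piFinset_univ] at h
    rw [hW, h]
    simp [sum_setWeight]
  have hs : ∀ V : Samples n N r, sampleWeight p V = ∏ t, W (V t) := fun _ => rfl
  simp_rw [hs]
  rw [sum_prod_mul_eq_resample hW1 t, sum_prod_mul_eq_resample hW1 t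
    (fun V => ∑ a, setWeight p a * g (resample V t i a))]
  refine Finset.sum_congr rfl fun V _ => ?_
  congr 1
  rw [sum_prod_mul_eq_resample (sum_setWeight p) i (fun R => g (Function.update V t R))]
  refine Finset.sum_congr rfl fun R _ => ?_
  simp [resample, hW]

theorem sampleProb_eq_sum (E : Samples n N r → Prop) [DecidablePred E] :
    sampleProb n N r p E = ∑ V, sampleWeight p V * (if E V then 1 else 0) := by
  rw [sampleProb, Finset.sum_filter]
  refine Finset.sum_congr rfl fun V _ => ?_
  split_ifs <;> simp

open Classical in
-- A bound that holds conditionally on all other samples holds unconditionally.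
theorem sampleProb_le_of_resample (h0 : 0 ≤ p) (h1 : p ≤ 1) (t : Fin N) (i : Fin r)
    {E : Samples n N r → Prop} {q : ℝ}
    (h : ∀ V, ∑ a, setWeight p a * (if E (resample V t i a) then 1 else 0) ≤ q) :
    sampleProb n N r p E ≤ q := by
  rw [sampleProb_eq_sum, sum_sampleWeight_mul_eq_resample t i]
  calc _ ≤ ∑ V : Samples n N r, sampleWeight p V * q := Finset.sum_le_sum fun V _ =>
        mul_le_mul_of_nonneg_left (h V) (sampleWeight_nonneg h0 h1 V)
    _ = q := by rw [← Finset.sum_mul, sum_sampleWeight, one_mul]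

theorem sampleProb_mono (h0 : 0 ≤ p) (h1 : p ≤ 1) {E E' : Samples n N r → Prop}
    (h : ∀ V, E V → E' V) : sampleProb n N r p E ≤ sampleProb n N r p E' := by
  classical
  exact Finset.sum_le_sum_of_subset_of_nonneg
    (fun V hV => by simp only [Finset.mem_filter] at hV ⊢; exact ⟨hV.1, h V hV.2⟩)
    fun V _ _ => sampleWeight_nonneg h0 h1 V

theorem sampleProb_or_le (h0 : 0 ≤ p) (h1 : p ≤ 1) (E E' : Samples n N r → Prop) :
    sampleProb n N r p (fun V => E V ∨ E' V) ≤ sampleProb n N r p E + sampleProb n N r p E' := by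
  classical
  rw [sampleProb_eq_sum, sampleProb_eq_sum, sampleProb_eq_sum, ← Finset.sum_add_distrib]
  refine Finset.sum_le_sum fun V _ => ?_
  rw [← mul_add]
  refine mul_le_mul_of_nonneg_left ?_ (sampleWeight_nonneg h0 h1 V)
  split_ifs <;> simp_all

theorem sampleProb_exists_le (h0 : 0 ≤ p) (h1 : p ≤ 1) {ι : Type*} [Fintype ι]
    (E : ι → Samples n N r → Prop) :
    sampleProb n N r p (fun V => ∃ i, E i V) ≤ ∑ i, sampleProb n N r p (E i) := by
  classical
  simp_rw [sampleProb_eq_sum]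
  rw [Finset.sum_comm]
  refine Finset.sum_le_sum fun V _ => ?_
  rw [← Finset.mul_sum]
  refine mul_le_mul_of_nonneg_left ?_ (sampleWeight_nonneg h0 h1 V)
  split_ifs with h
  · obtain ⟨i, hi⟩ := h
    exact (if_pos hi).ge.trans (Finset.single_le_sum (f := fun i => if E i V then (1 : ℝ) else 0)
      (fun i _ => by split_ifs <;> simp) (Finset.mem_univ i))
  · exact Finset.sum_nonneg fun i _ => by split_ifs <;> simp

theorem sampleProb_eq_one {E : Samples n N r → Prop} (h : ∀ V, E V) :
    sampleProb n N r p E = 1 := by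
  classical
  simp [sampleProb_eq_sum, h, sum_sampleWeight]

theorem one_sub_le_sampleProb (h0 : 0 ≤ p) (h1 : p ≤ 1) {E B : Samples n N r → Prop}
    (h : ∀ V, ¬ B V → E V) : 1 - sampleProb n N r p B ≤ sampleProb n N r p E := by
  have h2 := sampleProb_or_le h0 h1 E B
  have h3 : sampleProb n N r p (fun V => E V ∨ B V) = 1 :=
    sampleProb_eq_one fun V => (em (B V)).elim Or.inr fun hB => Or.inl (h V hB)
  linarith

theorem sampleProb_mem_le (h0 : 0 ≤ p) (h1 : p ≤ 1) (j : Fin n) :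
    sampleProb n N r p (fun V => ∃ t i, j ∈ V t i) ≤ N * (r * p) := by
  have h : ∀ (t : Fin N) (i : Fin r), sampleProb n N r p (fun V => j ∈ V t i) ≤ p := by
    intro t i
    refine sampleProb_le_of_resample h0 h1 t i fun V => ?_
    simp only [resample, Function.update_self]
    convert (sum_setWeight_mem p j).le
  calc _ ≤ ∑ t : Fin N, sampleProb n N r p (fun V => ∃ i, j ∈ V t i) :=
        sampleProb_exists_le h0 h1 fun t V => ∃ i, j ∈ V t i
    _ ≤ ∑ t : Fin N, ∑ i : Fin r, sampleProb n N r p (fun V => j ∈ V t i) :=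
        Finset.sum_le_sum fun t _ => sampleProb_exists_le h0 h1 fun i V => j ∈ V t i
    _ ≤ ∑ t : Fin N, ∑ i : Fin r, p :=
        Finset.sum_le_sum fun t _ => Finset.sum_le_sum fun i _ => h t i
    _ = _ := by simp

end Resampling

/-! ### Sampled elements rarely hurt `O` -/

section RandomSubset

/-- A random set that contains every element with probability at most `q` keeps a fraction `1 - q`
of the value of a non-negative submodular function at the empty set. -/
theorem one_sub_mul_le_sum {Ω : Type*} [Fintype Ω] {w : Ω → ℝ} (hw0 : ∀ ω, 0 ≤ w ω)
    (hw1 : ∑ ω, w ω = 1) (T : Ω → Finset (Fin n)) {q : ℝ} (hq : 0 ≤ q)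
    (hT : ∀ j, ∑ ω, w ω * (if j ∈ T ω then 1 else 0) ≤ q) {g : Finset (Fin n) → ℝ}
    (hg0 : ∀ S, 0 ≤ g S)
    (hg : ∀ A B : Finset (Fin n), A ⊆ B → ∀ j ∉ B, g (insert j B) - g B ≤ g (insert j A) - g A) :
    (1 - q) * g ∅ ≤ ∑ ω, w ω * g (T ω) := by
  set P : Fin n → ℝ := fun j => ∑ ω, w ω * (if j ∈ T ω then 1 else 0) with hP
  -- Elements are added in order of decreasing probability. Inserting `j` gains at least `P j * (g
  -- (insert j A) - g A)`, and the hypothesis with `m = P j` cancels the negative term. No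
  -- independence is needed, so `T` may be chosen adversarially.
  have key : ∀ A : Finset (Fin n), ∀ m ≤ q, (∀ j ∈ A, m ≤ P j) →
      (1 - q) * g ∅ + m * g A ≤ ∑ ω, w ω * g (T ω ∩ A) := by
    intro A
    induction A using Finset.induction_on_min_value P with
    | empty =>
      intro m hm _
      simp only [Finset.inter_empty, ← Finset.sum_mul, hw1, one_mul]
      nlinarith [hg0 ∅]
    | insert j A hj hmin ih =>
      intro m hm hmA
      have h1 := ih (P j) (hT j) hmin
      have h2 : ∀ ω, w ω * g (T ω ∩ A) +
          w ω * (if j ∈ T ω then 1 else 0) * (g (insert j A) - g A) ≤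
          w ω * g (T ω ∩ insert j A) := by
        intro ω
        by_cases hjT : j ∈ T ω
        · rw [Finset.inter_insert_of_mem hjT, if_pos hjT, mul_one, ← mul_add]
          refine mul_le_mul_of_nonneg_left ?_ (hw0 ω)
          linarith [hg (T ω ∩ A) A Finset.inter_subset_right j hj]
        · rw [Finset.inter_insert_of_notMem hjT, if_neg hjT]
          simp
      have h3 := Finset.sum_le_sum fun ω (_ : ω ∈ Finset.univ) => h2 ω
      rw [Finset.sum_add_distrib, ← Finset.sum_mul] at h3
      change _ + P j * _ ≤ _ at h3
      have h4 := mul_le_mul_of_nonneg_right (hmA j (Finset.mem_insert_self j A))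
        (hg0 (insert j A))
      linarith
  have := key Finset.univ 0 hq fun j _ =>
    Finset.sum_nonneg fun ω _ => mul_nonneg (hw0 ω) (by split_ifs <;> simp)
  simpa using this

variable {N r : ℕ} {p : ℝ}

theorem sampleProb_exists_bad_subset_le {f : Finset (Fin n) → ℝ} (hf0 : ∀ X, 0 ≤ f X)
    (hf : IsSubmodular f) (O : Finset (Fin n)) (h0 : 0 ≤ p) (h1 : p ≤ 1) {ε : ℝ} (hε : 0 < ε)
    (hp : N * (r * p) ≤ ε ^ 2) (U : Samples n N r → Finset (Fin n))
    (hU : ∀ V, ∀ j ∈ U V, ∃ t i, j ∈ V t i) :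
    sampleProb n N r p (fun V => ∃ T ⊆ U V, f (O ∪ T) < (1 - ε) * f O) ≤ ε := by
  classical
  have hex : ∀ V, ∃ T ∈ (U V).powerset, ∀ T' ∈ (U V).powerset, f (O ∪ T) ≤ f (O ∪ T') :=
    fun V => Finset.exists_min_image _ _ ⟨∅, by simp⟩
  choose T hTU hTmin using hex
  have hE : (1 - ε ^ 2) * f (O ∪ ∅) ≤ ∑ V : Samples n N r, sampleWeight p V * f (O ∪ T V) := by
    refine one_sub_mul_le_sum (g := fun S => f (O ∪ S)) (sampleWeight_nonneg h0 h1)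
      (sum_sampleWeight n N r p) T (sq_nonneg ε) (fun j => ?_) (fun S => hf0 _)
      fun A B hAB j hjB => ?_
    · rw [← sampleProb_eq_sum fun V => j ∈ T V]
      exact (sampleProb_mono h0 h1 fun V hj => hU V j (Finset.mem_powerset.1 (hTU V) hj)).trans
        ((sampleProb_mem_le h0 h1 j).trans hp)
    · have h := hf.union_add_inter_le (O ∪ insert j A) (O ∪ B)
      by_cases hjO : j ∈ O
      · have e1 : O ∪ insert j B = O ∪ B := by grind
        have e2 : O ∪ insert j A = O ∪ A := by grind
        rw [e1, e2]
        linarith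
      · have e1 : O ∪ insert j A ∪ (O ∪ B) = O ∪ insert j B := by grind
        have e2 : (O ∪ insert j A) ∩ (O ∪ B) = O ∪ A := by grind
        rw [e1, e2] at h
        linarith
  rw [Finset.union_empty] at hE
  obtain ⟨E, hEdef⟩ : ∃ E : Samples n N r → Prop,
      E = fun V => ∃ T ⊆ U V, f (O ∪ T) < (1 - ε) * f O := ⟨_, rfl⟩
  rw [← hEdef]
  -- Markov's inequality for `f O - f (O ∪ T V)`, which is non-negative because `∅` competes in the
  -- minimum.
  have hV : ∀ V, sampleWeight p V * f (O ∪ T V) ≤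
      sampleWeight p V * f O - sampleWeight p V * (if E V then 1 else 0) * (ε * f O) := by
    intro V
    rw [mul_assoc, ← mul_sub]
    refine mul_le_mul_of_nonneg_left ?_ (sampleWeight_nonneg h0 h1 V)
    split_ifs with h
    · obtain ⟨T', hT', hlt⟩ := hEdef ▸ h
      have := hTmin V T' (Finset.mem_powerset.2 hT')
      linarith
    · have := hTmin V ∅ (by simp)
      rw [Finset.union_empty] at this
      linarith
  have hsum := Finset.sum_le_sum fun V (_ : V ∈ Finset.univ) => hV V
  rw [Finset.sum_sub_distrib, ← Finset.sum_mul, ← Finset.sum_mul, sum_sampleWeight,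
    ← sampleProb_eq_sum E] at hsum
  rcases (hf0 O).eq_or_lt with hO | hO
  · have : sampleProb n N r p E = 0 := by
      rw [sampleProb, Finset.filter_false_of_mem, Finset.sum_empty]
      intro V _ hV'
      obtain ⟨T', -, hlt⟩ := hEdef ▸ hV'
      rw [← hO, mul_zero] at hlt
      exact absurd hlt (not_lt.2 (hf0 _))
    rw [this]
    exact hε.le
  · have h2 : sampleProb n N r p E * (ε * f O) ≤ ε * (ε * f O) := by nlinarith
    exact le_of_mul_le_mul_right h2 (by positivity)

end RandomSubset

/-! ### Each sample hits the large addable sets -/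

section Hitting

variable {f : Finset (Fin n) → ℝ} {M : Matroid (Fin n)} {r N : ℕ} {ε : ℝ} {tie : TieBreak n}

theorem epochSol_congr {pick : ℕ → (T : Finset (Fin n)) → T.Nonempty → Fin n} {x : Fin n → ℝ}
    {V V' : ℕ → Finset (Fin n)} {i : ℕ} (h : ∀ j < i, V j = V' j) :
    epochSol f M ε pick x V i = epochSol f M ε pick x V' i := by
  induction i with
  | zero => rfl
  | succ i ih =>
    rw [epochSol, epochSol, ih fun j hj => h j (by omega), h i (Nat.lt_succ_self i)]

theorem fracSol_congr {V V' : ℕ → ℕ → Finset (Fin n)} {t : ℕ}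
    (h : ∀ s < t, ∀ j < r, V s j = V' s j) :
    fracSol f M r ε tie V t = fracSol f M r ε tie V' t := by
  induction t with
  | zero => rfl
  | succ t ih =>
    rw [fracSol, fracSol, ih fun s hs => h s (by omega), epochSol_congr (h t (Nat.lt_succ_self t))]

/-- The state before a step depends only on earlier samples; this handles the adaptivity of the
algorithm. -/
theorem addable_resample (V : Samples n N r) (t : Fin N) (i : Fin r) (a : Finset (Fin n)) (τ : ℝ) :
    addable f M r ε tie (resample V t i a).toSeq t i τ = addable f M r ε tie V.toSeq t i τ := by
  have h1 : ∀ s < (t : ℕ), ∀ j < r, (resample V t i a).toSeq s j = V.toSeq s j := by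
    intro s hs j hj
    have hsN : s < N := hs.trans t.2
    have : (⟨s, hsN⟩ : Fin N) ≠ t := fun h => by rw [← h] at hs; exact lt_irrefl _ hs
    simp only [Samples.toSeq, hsN, hj, and_self, dite_true, resample,
      Function.update_of_ne this]
  have h2 : ∀ j < (i : ℕ), (resample V t i a).toSeq t j = V.toSeq t j := by
    intro j hj
    have hjr : j < r := hj.trans i.2
    have : (⟨j, hjr⟩ : Fin r) ≠ i := fun h => by rw [← h] at hj; exact lt_irrefl _ hj
    simp only [Samples.toSeq, t.2, hjr, and_self, dite_true, resample, Fin.eta,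
      Function.update_self, Function.update_of_ne this]
  rw [addable, addable, intSol, intSol, fracSol_congr h1, epochSol_congr h2]

theorem sampleProb_not_hitsLarge_le {p : ℝ} (h0 : 0 ≤ p) (h1 : p ≤ 1) (k : ℝ) (t : Fin N)
    (i : Fin r) :
    sampleProb n N r p (fun V => ¬ HitsLarge f M r ε tie V.toSeq k t i) ≤ Real.exp (-(p * k)) := by
  classical
  refine sampleProb_le_of_resample h0 h1 t i fun V => ?_
  set A : ℝ → Set (Fin n) := fun τ => addable f M r ε tie V.toSeq t i τ with hA
  have hanti : Antitone A := fun τ τ' h e he => ⟨he.1, h.trans he.2⟩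
  have hmem : ∀ a, (resample V t i a).toSeq t i = a := by
    intro a
    simp [Samples.toSeq, resample]
  have hiff : ∀ a, HitsLarge f M r ε tie (resample V t i a).toSeq k t i ↔
      ∀ τ, k < (A τ).ncard → ∃ e ∈ a, e ∈ A τ := by
    intro a
    simp only [HitsLarge, addable_resample, hmem, hA]
  simp_rw [hiff]
  -- The sets `A τ` form a chain, so hitting the smallest large one hits them all, without a union
  -- bound over `τ`.
  by_cases hex : ∃ m : ℕ, ∃ τ, (A τ).ncard = m ∧ k < m
  · obtain ⟨τ, hτ, hk⟩ := Nat.find_spec hex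
    have hmin : ∀ τ', k < (A τ').ncard → A τ ⊆ A τ' := by
      intro τ' hk'
      have hle : (A τ).ncard ≤ (A τ').ncard := hτ ▸ Nat.find_min' hex ⟨τ', rfl, hk'⟩
      rcases le_total τ' τ with h | h
      · exact hanti h
      · exact (Set.eq_of_subset_of_ncard_le (hanti h) hle).ge
    have hle : ∀ a : Finset (Fin n),
        (if ¬ ∀ τ, k < (A τ).ncard → ∃ e ∈ a, e ∈ A τ then (1 : ℝ) else 0) ≤
          if Disjoint a (A τ).toFinset then 1 else 0 := by
      intro a
      by_cases hd : Disjoint a (A τ).toFinset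
      · rw [if_pos hd]; split_ifs <;> simp
      · rw [if_neg hd, if_neg]
        obtain ⟨e, he, heA⟩ := Finset.not_disjoint_iff.1 hd
        exact not_not.2 fun τ' hk' => ⟨e, he, hmin τ' hk' (by simpa using heA)⟩
    calc _ ≤ ∑ a : Finset (Fin n), setWeight p a *
          (if Disjoint a (A τ).toFinset then 1 else 0) := Finset.sum_le_sum fun a _ =>
          mul_le_mul_of_nonneg_left (hle a) (setWeight_nonneg h0 h1 a)
      _ = (1 - p) ^ (A τ).ncard := by
          rw [sum_setWeight_disjoint, ← Set.ncard_eq_toFinset_card']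
      _ ≤ Real.exp (-p) ^ (A τ).ncard :=
          pow_le_pow_left₀ (by linarith) (by linarith [Real.add_one_le_exp (-p)]) _
      _ = Real.exp ((A τ).ncard * -p) := (Real.exp_nat_mul _ _).symm
      _ ≤ _ := by
          rw [← hτ] at hk
          exact Real.exp_le_exp.2 (by nlinarith)
  · have : ∀ a : Finset (Fin n), ∀ τ, k < (A τ).ncard → ∃ e ∈ a, e ∈ A τ :=
      fun a τ hk => absurd ⟨_, τ, rfl, hk⟩ hex
    refine le_trans (Finset.sum_eq_zero fun a _ => ?_).le (Real.exp_pos _).le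
    rw [if_neg (not_not.2 (this a)), mul_zero]

end Hitting

/-! ### Assembling the guarantee -/

theorem mem_biUnion_toSeq {N r : ℕ} {V : Samples n N r} {j : Fin n}
    (h : j ∈ (Finset.range N).biUnion fun t => (Finset.range r).biUnion (V.toSeq t)) :
    ∃ t i, j ∈ V t i := by
  obtain ⟨t, ht, h⟩ := Finset.mem_biUnion.1 h
  obtain ⟨i, hi, h⟩ := Finset.mem_biUnion.1 h
  rw [Finset.mem_range] at ht hi
  rw [Samples.toSeq, dif_pos ⟨ht, hi⟩] at h
  exact ⟨_, _, h⟩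

/-- Lets the rounding error `ε² v` per epoch be charged to `f O`. Singletons of non-loops are
feasible; loops are covered only by assumption. -/
theorem IsOptimal.maxSingleton_le {f : Finset (Fin n) → ℝ} {M : Matroid (Fin n)}
    {O : Finset (Fin n)} (hO : IsOptimal f M O) (hf0 : ∀ X, 0 ≤ f X)
    (hloop : ∀ e : Fin n, ¬ M.Indep {e} → f {e} ≤ f O) : maxSingleton f ≤ f O := by
  refine Real.iSup_le (fun e => ?_) (hf0 O)
  by_cases he : M.Indep {e}
  · exact hO.2 {e} (by simpa using he)
  · exact hloop e he

/-- The guarantee of the subroutine for all outcomes of the sampling outside of two unlikely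
events. -/
theorem continuousGreedyFiltering_spec {f : Finset (Fin n) → ℝ} (hf0 : ∀ X, 0 ≤ f X)
    (hf : IsSubmodular f) {M : Matroid (Fin n)} (hE : M.E = Set.univ) {r : ℕ} (hr : M.eRank = r)
    (hr0 : 0 < r) {ε : ℝ} (hε0 : 0 < ε) (hε : ε < 1 / 4) (hN : (⌊1 / ε⌋₊ : ℝ) * ε = 1)
    (tie : TieBreak n) {O : Finset (Fin n)} (hO : IsOptimal f M O) (hv : maxSingleton f ≤ f O)
    {V : ℕ → ℕ → Finset (Fin n)}
    (hhit : ∀ t < ⌊1 / ε⌋₊, ∀ i < r,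
      HitsLarge f M r ε tie V (r * Real.log (r / ε ^ 2) / ε ^ 3) t i)
    (hU : ∀ T ⊆ (Finset.range ⌊1 / ε⌋₊).biUnion (fun t => (Finset.range r).biUnion (V t)),
      (1 - ε) * f O ≤ f (O ∪ T)) :
    ∃ X ⊆ (continuousGreedyFiltering f M r ε tie V).1, M.Indep (X : Set (Fin n)) ∧
      (1 - 1 / Real.exp 1) *
        (f (O \ (continuousGreedyFiltering f M r ε tie V).2) - 8 * ε * f O) ≤ f X := by
  classical
  have hr' : (1 : ℝ) ≤ r := by exact_mod_cast hr0
  have hlog : 0 ≤ Real.log (r / ε ^ 2) := by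
    refine Real.log_nonneg ((one_le_div (by positivity)).2 ?_)
    nlinarith
  set k := r * Real.log (r / ε ^ 2) / ε ^ 3 with hk
  have hcard := card_passesFilter_le hf hε0.le hN (k := k) (by positivity) hhit
  -- The count of filtered elements is bounded by exactly the cutoff of the loop.
  have hbound : (⌊1 / ε⌋₊ : ℝ) * ((grid r ε (maxSingleton f)).card * k) =
      r * Real.log (r / ε ^ 2) * (grid r ε (maxSingleton f)).card / ε ^ 4 := by
    rw [eq_div_of_mul_eq hε0.ne' hN, hk]
    field_simp
  rw [hbound] at hcard
  have hout : continuousGreedyFiltering f M r ε tie V =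
      ((Finset.range ⌊1 / ε⌋₊).biUnion (fun t => intSol f M r ε tie V t r),
        Finset.univ.filter (PassesFilter f M r ⌊1 / ε⌋₊ ε tie V)) := by
    rw [continuousGreedyFiltering]
    simp only [if_neg hr0.ne']
    rw [filterLoop_eq _ (by convert hcard) _ _ (Finset.empty_subset _), Finset.empty_union]
    congr 1
    ext j
    simp
  rw [hout]
  obtain ⟨X, hXS, hXi, hle⟩ := hf.exists_rounding hE hε0.le
    (fun t => intSol f M r ε tie V t r) (fun t => epochSol_indep (tie.pick_mem t) _ _ r)
    ⌊1 / ε⌋₊ 0 le_rfl (fun i => by rw [hN, Pi.zero_apply, zero_add])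
  refine ⟨X, hXS, hXi, ?_⟩
  rw [hN, one_smul, zero_add, zero_add, multilinear_ind, ← fracSol_eq_sum] at hle
  refine le_trans (multilinear_fracSol_ge hf0 hf hE hr hr0 hε0 hε hN hO hv ?_ hU) hle
  intro o ho hpass
  exact (Finset.mem_sdiff.1 ho).2 (Finset.mem_filter.2 ⟨Finset.mem_univ o, hpass⟩)

theorem rank_zero_bound {f : Finset (Fin n) → ℝ} (hf0 : ∀ X, 0 ≤ f X) {M : Matroid (Fin n)}
    (hr : M.eRank = 0) {ε : ℝ} (hε0 : 0 < ε) (tie : TieBreak n) {O : Finset (Fin n)}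
    (hO : IsOptimal f M O) (V : ℕ → ℕ → Finset (Fin n)) :
    ∃ X ⊆ (continuousGreedyFiltering f M 0 ε tie V).1, M.Indep (X : Set (Fin n)) ∧
      (1 - 1 / Real.exp 1) *
        (f (O \ (continuousGreedyFiltering f M 0 ε tie V).2) - 8 * ε * f O) ≤ f X := by
  have hO0 : O = ∅ := by
    have := hO.1.encard_le_eRank
    rw [hr] at this
    simpa using this
  refine ⟨∅, by simp, by simp, ?_⟩
  simp only [continuousGreedyFiltering, if_true, Finset.sdiff_empty, hO0]
  have hE1 : 1 / Real.exp 1 ≤ 1 :=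
    (div_le_one (Real.exp_pos 1)).2 (by linarith [Real.add_one_le_exp (1 : ℝ)])
  have hE0 : 0 ≤ 1 / Real.exp 1 := by positivity
  have h1 : 0 ≤ 8 * ε * f ∅ := mul_nonneg (by linarith) (hf0 ∅)
  have h2 := mul_nonneg (sub_nonneg.2 hE1) h1
  have h3 := mul_nonneg hE0 (hf0 ∅)
  linarith

end ContGreedy

theorem mainTheorem3 (n : ℕ) (f : Finset (Fin n) → ℝ) (hf0 : ∀ X, 0 ≤ f X)
    (hf : ContGreedy.IsSubmodular f) (M : Matroid (Fin n)) (hE : M.E = Set.univ)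
    (r : ℕ) (hr : M.eRank = r) (ε : ℝ) (hε : ε < 1 / 4)
    (hεinv : ∃ m : ℕ, 0 < m ∧ 1 / ε = m) (tie : ContGreedy.TieBreak n)
    (O : Finset (Fin n)) (hO : ContGreedy.IsOptimal f M O)
    (hloop : r ≠ 0 → ∀ e : Fin n, ¬ M.Indep {e} → f {e} ≤ f O) :
    1 - 2 * ε ≤ ContGreedy.sampleProb n ⌊1 / ε⌋₊ r (ε ^ 3 / r) (fun V =>
      ∃ X ⊆ (ContGreedy.continuousGreedyFiltering f M r ε tie V.toSeq).1,
        M.Indep (X : Set (Fin n)) ∧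
        (1 - 1 / Real.exp 1) *
          (f (O \ (ContGreedy.continuousGreedyFiltering f M r ε tie V.toSeq).2) - 8 * ε * f O)
            ≤ f X) := by
  obtain ⟨m, hm0, hm⟩ := hεinv
  have hε0 : 0 < ε := by
    have : (0 : ℝ) < 1 / ε := by rw [hm]; exact_mod_cast hm0
    exact one_div_pos.1 this
  have hN : (⌊1 / ε⌋₊ : ℝ) * ε = 1 := by
    rw [hm, Nat.floor_natCast, ← hm]
    exact one_div_mul_cancel hε0.ne'
  rcases Nat.eq_zero_or_pos r with rfl | hr0
  · rw [ContGreedy.sampleProb_eq_one fun V =>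
      ContGreedy.rank_zero_bound hf0 (by simpa using hr) hε0 tie hO V.toSeq]
    linarith
  have hr' : (1 : ℝ) ≤ r := by exact_mod_cast hr0
  have hv := hO.maxSingleton_le hf0 (hloop hr0.ne')
  have hp0 : 0 ≤ ε ^ 3 / r := by positivity
  have hp1 : ε ^ 3 / r ≤ 1 :=
    (div_le_one (by linarith)).2 ((pow_le_one₀ hε0.le (by linarith)).trans hr')
  set N := ⌊1 / ε⌋₊ with hNdef
  set k := r * Real.log (r / ε ^ 2) / ε ^ 3 with hk
  have hbad1 : ContGreedy.sampleProb n N r (ε ^ 3 / r) (fun V =>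
      ∃ t : Fin N, ∃ i : Fin r, ¬ ContGreedy.HitsLarge f M r ε tie V.toSeq k t i) ≤ ε := by
    -- `k` is chosen so that `p k = ln(r/ε²)`; summed over the `r/ε` steps, the failure
    -- probabilities give `ε`.
    have hexp : Real.exp (-(ε ^ 3 / r * k)) = ε ^ 2 / r := by
      have : ε ^ 3 / r * k = Real.log (r / ε ^ 2) := by
        rw [hk]
        field_simp
      rw [this, Real.exp_neg, Real.exp_log (by positivity), inv_div]
    calc _ ≤ ∑ t : Fin N, ContGreedy.sampleProb n N r (ε ^ 3 / r) (fun V =>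
          ∃ i : Fin r, ¬ ContGreedy.HitsLarge f M r ε tie V.toSeq k t i) :=
          ContGreedy.sampleProb_exists_le hp0 hp1 fun (t : Fin N) V =>
            ∃ i : Fin r, ¬ ContGreedy.HitsLarge f M r ε tie V.toSeq k t i
      _ ≤ ∑ t : Fin N, ∑ i : Fin r, ContGreedy.sampleProb n N r (ε ^ 3 / r) (fun V =>
          ¬ ContGreedy.HitsLarge f M r ε tie V.toSeq k t i) :=
          Finset.sum_le_sum fun t _ => ContGreedy.sampleProb_exists_le hp0 hp1
            fun (i : Fin r) V => ¬ ContGreedy.HitsLarge f M r ε tie V.toSeq k t i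
      _ ≤ ∑ t : Fin N, ∑ i : Fin r, ε ^ 2 / r :=
          Finset.sum_le_sum fun t _ => Finset.sum_le_sum fun i _ =>
            (ContGreedy.sampleProb_not_hitsLarge_le hp0 hp1 k t i).trans_eq hexp
      _ = (N * ε) * ε := by
          simp only [Finset.sum_const, Finset.card_univ, Fintype.card_fin, nsmul_eq_mul]
          field_simp
      _ = ε := by rw [hN, one_mul]
  have hbad2 := ContGreedy.sampleProb_exists_bad_subset_le (N := N) (r := r) (p := ε ^ 3 / r) hf0 hf
    O hp0 hp1 hε0 (by
      have : (N : ℝ) * (r * (ε ^ 3 / r)) = (N * ε) * ε ^ 2 := by field_simp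
      rw [this, hN, one_mul])
    (fun V => (Finset.range N).biUnion fun t => (Finset.range r).biUnion (V.toSeq t))
    (fun V j => ContGreedy.mem_biUnion_toSeq)
  have hor := ContGreedy.sampleProb_or_le (n := n) (N := N) (r := r) hp0 hp1
    (fun V => ∃ t : Fin N, ∃ i : Fin r, ¬ ContGreedy.HitsLarge f M r ε tie V.toSeq k t i)
    (fun V => ∃ T ⊆ (Finset.range N).biUnion fun t => (Finset.range r).biUnion (V.toSeq t),
      f (O ∪ T) < (1 - ε) * f O)
  refine le_trans ?_ (ContGreedy.one_sub_le_sampleProb hp0 hp1 (B := fun V =>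
    (∃ t : Fin N, ∃ i : Fin r, ¬ ContGreedy.HitsLarge f M r ε tie V.toSeq k t i) ∨
    ∃ T ⊆ (Finset.range N).biUnion fun t => (Finset.range r).biUnion (V.toSeq t),
      f (O ∪ T) < (1 - ε) * f O) fun V hV => ?_)
  · linarith
  · rw [not_or] at hV
    obtain ⟨h1, h2⟩ := hV
    push Not at h1 h2
    exact ContGreedy.continuousGreedyFiltering_spec hf0 hf hE hr hr0 hε0 hε hN tie hO hv
      (fun t ht i hi => h1 ⟨t, ht⟩ ⟨i, hi⟩) h2
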